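/- Fix constants $\alpha,\beta\ge 1$. For $\theta\in(0,\infty)^n$, a pair $(z,B)$ with $z\in[k]^n$ and $B=B^T\in\mathbb{R}^{k\times k}$ is called a generative model in $\mathcal P_n'(\theta,p,q,k,\beta;\delta,\alpha)$ if $P_{ij}:=\theta_i\theta_jB_{z(i)z(j)}\mathbf 1\{i\ne j\}\in[0,1]$ for all $i,j$, $\max_{u\ne v}B_{uv}\le q<p\le\min_uB_{uu}\le\max_uB_{uu}\le\alpha p$, and for every $u\in[k]$ the size $n_u=|\{i:z(i)=u\}|$ satisfies $\frac{n}{\beta k}-1\le n_u\le\frac{\beta n}{k}+1$ and $(1-\delta)n_u\le\sum_{z(i)=u}\theta_i\le(1+\delta)n_u$. The observed adjacency matrix $A$ is symmetric with zero diagonal and independent entries $A_{ij}\sim\mathrm{Bern}(P_{ij})$, $i<j$. Algorithm (weighted $k$-medians, with threshold $\tau$ and slack $\epsilon\ge0$). Let $T_\tau(A)$ be $A$ with every row and column whose row sum exceeds $\tau$ replaced by zeros; let $\hat P$ be any minimizer of $\|T_\tau(A)-Q\|_F$ over matrices $Q$ with $\mathrm{rank}(Q)\le k$; let $\hat P_i$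 be its rows, $S_0=\{i:\|\hat P_i\|_1=0\}$, and set $\hat z(i)=0$ for $i\in S_0$ and $\tilde P_i=\hat P_i/\|\hat P_i\|_1$ for $i\notin S_0$; finally let $(\hat z(i))_{i\notin S_0}$ be any labels in $[k]$ with $$\sum_{u=1}^k\min_{v\in\mathbb R^n}\sum_{i\notin S_0,\hat z(i)=u}\|\hat P_i\|_1\|\tilde P_i-v\|_1\le(1+\epsilon)\min_{z'\in[k]^n}\sum_{u=1}^k\min_{v\in\mathbb R^n}\sum_{i\notin S_0,z'(i)=u}\|\hat P_i\|_1\|\tilde P_i-v\|_1 .$$ Let $\ell(\hat z,z)=\frac1n\min_{\pi}|\{i:\hat z(i)\ne\pi(z(i))\}|$, where $\pi$ ranges over the permutations of $[k]$, and define $I$ by $e^{-I}=\frac1n\sum_{i=1}^n\exp(-\theta_i\frac n2(\sqrt p-\sqrt q)^2)$ if $k=2$ and $e^{-I}=\frac1n\sum_{i=1}^n\exp(-\theta_i\frac n{\beta k}(\sqrt p-\sqrt q)^2)$ if $k\ge3$. Statement. Let $M,K,L$ and $m>0$ be constants. If $C_1$ is a sufficiently large constant (how large depends only on $\alpha,\beta,M,K,m,L$),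 then there are constants $C,C'>0$, depending only on $\alpha,\beta,M,K,m,L,C_1$, such that the following holds for all sequences (indexed by $n\ge1$) of parameters $\theta\in\mathbb R^n$, $p,q,\delta,\epsilon\in\mathbb R$, $k\in\mathbb N$ with $$\delta\to0,\quad q>0,\quad 1<p/q\le M,\quad p\ge n^{-1},\quad 2\le k\le K,\quad m\le\min_i\theta_i\le\|\theta\|_\infty\le L,\quad \epsilon\ge0 .$$ Run the algorithm with $\tau=C_1(np\|\theta\|_\infty^2+1)$. Then for all sufficiently large $n$ and every generative model in $\mathcal P_n'(\theta,p,q,k,\beta;\delta,\alpha)$, $$\ell(\hat z,z)\le C(1+\epsilon)I^{-1/2}\quad\text{with probability at least }1-n^{-(1+C')} .$$ Moreover, if $C$ is replaced by a constant that may also depend on the sequence of parameters, the same holds for every $n\ge1$. -/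

import Mathlib

open MeasureTheory ProbabilityTheory Filter Topology

universe u

noncomputable section

namespace DCBM

/-- The size `n_u` of community `u` under the label vector `z`. -/
def communitySize {n k : ℕ} (z : Fin n → Fin k) (u : Fin k) : ℕ :=
  (Finset.univ.filter fun i => z i = u).card

/-- The matrix of edge probabilities: `P_ii = 0` and `P_ij = θ_i θ_j B_{z(i) z(j)}` for `i ≠ j`. -/
def edgeProb {n k : ℕ} (θ : Fin n → ℝ) (z : Fin n → Fin k) (B : Matrix (Fin k) (Fin k) ℝ) :
    Matrix (Fin n) (Fin n) ℝ :=
  Matrix.of fun i j => if i = j then 0 else θ i * θ j * B (z i) (z j)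

/-- The pair `(z, B)` is a generative model of the parameter space
`P'_n(θ, p, q, k, β; δ, α)`: it generates a matrix of edge probabilities of that space.
The normalization `(1 / n_u) ∑_{z(i) = u} θ_i ∈ [1 - δ, 1 + δ]` is written without division. -/
structure IsModel {n k : ℕ} (θ : Fin n → ℝ) (p q β δ α : ℝ) (z : Fin n → Fin k)
    (B : Matrix (Fin k) (Fin k) ℝ) : Prop where
  symm : B.IsSymm
  prob_mem : ∀ i j, edgeProb θ z B i j ∈ Set.Icc (0 : ℝ) 1
  normalized : ∀ u, (1 - δ) * (communitySize z u : ℝ) ≤ ∑ i with z i = u, θ i ∧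
    ∑ i with z i = u, θ i ≤ (1 + δ) * (communitySize z u : ℝ)
  between_le : ∀ u v, u ≠ v → B u v ≤ q
  gap : q < p
  le_within : ∀ u, p ≤ B u u
  within_le : ∀ u, B u u ≤ α * p
  size_lower : ∀ u, (n : ℝ) / (β * k) - 1 ≤ (communitySize z u : ℝ)
  size_upper : ∀ u, (communitySize z u : ℝ) ≤ β * n / k + 1

/-- `A` is the random adjacency matrix of an undirected graph without loops, whose edges
`{i, j}`, `i < j`, are independent Bernoulli variables with success probabilities `P_ij`. -/
structure IsRandomAdjacency {n : ℕ} {Ω : Type*} [MeasurableSpace Ω] (μ : Measure Ω)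
    (A : Ω → Matrix (Fin n) (Fin n) ℝ) (P : Matrix (Fin n) (Fin n) ℝ) : Prop where
  measurable : ∀ i j, Measurable fun ω => A ω i j
  zero_or_one : ∀ ω i j, A ω i j = 0 ∨ A ω i j = 1
  diag : ∀ ω i, A ω i i = 0
  symm : ∀ ω i j, A ω i j = A ω j i
  prob : ∀ i j, i < j → μ {ω | A ω i j = 1} = ENNReal.ofReal (P i j)
  indep : iIndepFun (fun (e : {e : Fin n × Fin n // e.1 < e.2}) ω => A ω e.1.1 e.1.2) μ

/-- The `ℓ¹` norm of a vector. -/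
def l1 {n : ℕ} (x : Fin n → ℝ) : ℝ := ∑ j, |x j|

/-- The squared Frobenius norm of a matrix. -/
def frobSq {n : ℕ} (X : Matrix (Fin n) (Fin n) ℝ) : ℝ := ∑ i, ∑ j, X i j ^ 2

/-- `T_τ(A)`: the rows and columns of `A` whose row sum is larger than `τ` are set to zero. -/
def trim {n : ℕ} (τ : ℝ) (A : Matrix (Fin n) (Fin n) ℝ) : Matrix (Fin n) (Fin n) ℝ :=
  Matrix.of fun i j => if τ < ∑ l, A i l ∨ τ < ∑ l, A j l then 0 else A i j

/-- `Phat` minimizes the Frobenius distance to `T` among matrices of rank at most `k`. -/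
def IsBestLowRank {n : ℕ} (k : ℕ) (T Phat : Matrix (Fin n) (Fin n) ℝ) : Prop :=
  Phat.rank ≤ k ∧ ∀ Q : Matrix (Fin n) (Fin n) ℝ, Q.rank ≤ k → frobSq (T - Phat) ≤ frobSq (T - Q)

/-- The weighted `k`-medians objective of a labelling, over the rows of `Phat` that are nonzero:
`∑_u min_v ∑_{i ∉ S₀, z(i) = u} ‖Phat_i‖₁ ‖Phat_i / ‖Phat_i‖₁ - v‖₁`. -/
def kMediansCost {n k : ℕ} (Phat : Matrix (Fin n) (Fin n) ℝ) (z : Fin n → Option (Fin k)) : ℝ :=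
  ∑ u : Fin k, ⨅ v : Fin n → ℝ, ∑ i with l1 (Phat i) ≠ 0 ∧ z i = some u,
    l1 (Phat i) * l1 ((l1 (Phat i))⁻¹ • Phat i - v)

/-- `zhat` is a possible output of weighted `k`-medians clustering with threshold `τ` and
slack `ε`. The label `none` is the label `0` given to the vertices of
`S₀ = {i | ‖Phat_i‖₁ = 0}`; the other vertices have a label in `[k]`, and these labels solve the
`(1 + ε)`-approximate weighted `k`-medians problem. -/
def IsClusteringOutput {n k : ℕ} (τ ε : ℝ) (A : Matrix (Fin n) (Fin n) ℝ)
    (zhat : Fin n → Option (Fin k)) : Prop :=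
  ∃ Phat : Matrix (Fin n) (Fin n) ℝ, IsBestLowRank k (trim τ A) Phat ∧
    (∀ i, zhat i = none ↔ l1 (Phat i) = 0) ∧
    ∀ z' : Fin n → Fin k,
      kMediansCost Phat zhat ≤ (1 + ε) * kMediansCost Phat fun i => some (z' i)

/-- The misclassification proportion `(1 / n) min_π H(zhat, π(z))`, where `π` runs through the
permutations of the labels and `H` is the Hamming distance. A vertex labelled `none`
counts as misclassified. -/
def loss {n k : ℕ} (zhat : Fin n → Option (Fin k)) (z : Fin n → Fin k) : ℝ :=
  ((⨅ π : Equiv.Perm (Fin k), hammingDist zhat (fun i => some (π (z i))) : ℕ) : ℝ) / n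

/-- The quantity `I`, defined by
`exp(-I) = (1 / n) ∑_i exp(-θ_i (n / 2) (√p - √q)²)` if `k = 2` and by
`exp(-I) = (1 / n) ∑_i exp(-θ_i (n / (β k)) (√p - √q)²)` if `k ≥ 3`. -/
def info {n : ℕ} (θ : Fin n → ℝ) (p q : ℝ) (k : ℕ) (β : ℝ) : ℝ :=
  -Real.log ((1 / (n : ℝ)) * ∑ i, Real.exp
    (-(θ i * (if k = 2 then (n : ℝ) / 2 else (n : ℝ) / (β * k)) * (√p - √q) ^ 2)))

/-- For every generative model in `P'_n(θ, p, q, k, β; δ, α)` and every output `zhat` of the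
clustering algorithm with threshold `τ` and slack `ε`, applied to the random adjacency matrix,
`ℓ(zhat, z) ≤ C (1 + ε) I^{-1/2}` with probability at least `1 - n^{-(1 + C')}`. -/
def LossBound {n : ℕ} (θ : Fin n → ℝ) (p q : ℝ) (k : ℕ) (β δ α τ ε C C' : ℝ) : Prop :=
  ∀ (z : Fin n → Fin k) (B : Matrix (Fin k) (Fin k) ℝ), IsModel θ p q β δ α z B →
  ∀ (Ω : Type u) [MeasurableSpace Ω] (μ : Measure Ω) [IsProbabilityMeasure μ]
    (A : Ω → Matrix (Fin n) (Fin n) ℝ), IsRandomAdjacency μ A (edgeProb θ z B) →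
  ∀ zhat : Ω → Fin n → Option (Fin k), (∀ ω, IsClusteringOutput τ ε (A ω) (zhat ω)) →
    1 - (n : ℝ) ^ (-(1 + C')) ≤
      μ.real {ω | loss (zhat ω) z ≤ C * (1 + ε) * info θ p q k β ^ (-(1 / 2 : ℝ))}

end DCBM

end

/-!
The algorithm replaces the trimmed adjacency matrix `T` by its best approximation `Phat` of rank
`k` and clusters the rows. The matrix `Q = fullProb θ z B`, which is the matrix `P` of edge
probabilities with its diagonal filled in, has rank at most `k`, and its normalized rows take one
value per community. With `d = α (n p ‖θ‖² + 1)`, of the order of the largest expected degree, the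
proof has three parts.

*Spectral norm.* With probability at least `1 - n⁻²` the trimmed matrix satisfies
`‖T - P_trimmed‖ ≤ C √d` (`bilinBound_cutMatrix`). This is the Kahn–Szemerédi argument in the form of
Feige and Ofek. For `v`, `w` in an integer net, the pairs with `|v i * w j| ≤ √d` are handled by a
Chernoff bound and a union bound over the net (`measure_exists_light_le`). On the other, heavy,
pairs the absolute values are summed (`sum_heavy_le`): if one coordinate exceeds the other by a
factor `√d`, the bound on the remaining degrees suffices; otherwise both vectors are cut into
dyadic levels, and the number of edges between two levels is bounded by the discrepancy property
(`measure_not_hasDiscrepancy_le`, `mul_edges_le_levelBound`), after which only geometric series are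
left.

*Low rank.* Since `Q` competes with `Phat`, the error `X = Phat - Q` satisfies
`‖X‖_F² ≤ 2 ⟨X, T - Q⟩`. Here `T - Q` is the sum of the spectrally small matrix above and a matrix
of Frobenius norm `O(√d)`, as fewer than `n / d` vertices are trimmed
(`measure_exists_heavy_set_le`). The rank of `X` being at most `2 k`, duality of spectral and
nuclear norm gives `‖X‖_F ≤ C √d` (`IsBestLowRank.sqrt_frobSq_sub_le`), whence
`∑ ‖Phat_i - Q_i‖₁ ≤ C n √d`.

*Clustering.* The rows of `Q` have `ℓ¹` norm of order `n p`, and the normalized rows of two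
communities are at distance at least of order `(p - q) / p` (`IsModel.le_l1_sub_normalized`). A
misclassified vertex costs the product of these two quantities in the weighted `k`-medians
objective, whose value is at most a multiple of `(1 + ε) n √d` (`loss_le_of_isClusteringOutput`).
The proportion of errors is therefore at most a multiple of `(1 + ε) √p / (√n (p - q))`, and
`I ≤ L n (√p - √q)² ≤ L n (p - q)² / p` turns this into `(1 + ε) I^{-1/2}`
(`inv_le_sqrt_mul_info_rpow`).

For the finitely many `n` not covered by these estimates, `loss ≤ 1` and `I > 0` suffice.
-/

noncomputable section

namespace DCBM

/-! ### Linear statistics of the adjacency matrix -/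

section

theorem sum_sum_eq_sum_edges {n : ℕ} (M : Fin n → Fin n → ℝ) (hM : ∀ i, M i i = 0) :
    ∑ i, ∑ j, M i j =
      ∑ e : {e : Fin n × Fin n // e.1 < e.2}, (M e.1.1 e.1.2 + M e.1.2 e.1.1) := by
  have h1 : ∀ N : Fin n → Fin n → ℝ, ∑ e : {e : Fin n × Fin n // e.1 < e.2}, N e.1.1 e.1.2 =
      ∑ i, ∑ j, if i < j then N i j else 0 := by
    intro N
    rw [← Finset.sum_product', Finset.univ_product_univ, ← Finset.sum_filter]
    exact (Finset.sum_subtype _ (by simp) fun e : Fin n × Fin n => N e.1 e.2).symm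
  rw [Finset.sum_add_distrib, h1 M, h1 fun i j => M j i,
    Finset.sum_comm (f := fun i j => if i < j then M j i else 0), ← Finset.sum_add_distrib]
  refine Finset.sum_congr rfl fun i _ => ?_
  rw [← Finset.sum_add_distrib]
  refine Finset.sum_congr rfl fun j _ => ?_
  rcases lt_trichotomy i j with h | h | h
  · simp [h, h.not_gt]
  · subst h; simp [hM]
  · simp [h, h.not_gt]

variable {n : ℕ} {Ω : Type u} [MeasurableSpace Ω] {μ : Measure Ω}
  {A : Ω → Matrix (Fin n) (Fin n) ℝ} {P : Matrix (Fin n) (Fin n) ℝ}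

theorem IsRandomAdjacency.abs_le_one (hA : IsRandomAdjacency μ A P) (ω : Ω) (i j : Fin n) :
    |A ω i j| ≤ 1 := by
  rcases hA.zero_or_one ω i j with h | h <;> simp [h]

theorem IsRandomAdjacency.nonneg (hA : IsRandomAdjacency μ A P) (ω : Ω) (i j : Fin n) :
    0 ≤ A ω i j := by
  rcases hA.zero_or_one ω i j with h | h <;> simp [h]

theorem IsRandomAdjacency.integral_edge (hA : IsRandomAdjacency μ A P) {i j : Fin n}
    (hij : i < j) (hP : 0 ≤ P i j) : ∫ ω, A ω i j ∂μ = P i j := by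
  have h : (fun ω => A ω i j) = Set.indicator {ω | A ω i j = 1} fun _ => (1 : ℝ) := by
    funext ω
    rcases hA.zero_or_one ω i j with h | h <;> simp [Set.indicator, h]
  have hm : MeasurableSet {ω | A ω i j = 1} := hA.measurable i j (measurableSet_singleton 1)
  rw [h, integral_indicator_const _ hm, Measure.real, hA.prob i j hij, ENNReal.toReal_ofReal hP]
  simp

variable [IsProbabilityMeasure μ]

theorem IsRandomAdjacency.integrable_exp (hA : IsRandomAdjacency μ A P)
    (c : Fin n → Fin n → ℝ) :
    Integrable (fun ω => Real.exp (∑ i, ∑ j, c i j * A ω i j)) μ := by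
  have hm := hA.measurable
  refine Integrable.of_bound (C := Real.exp (∑ i, ∑ j, |c i j|)) ?_ (ae_of_all _ fun ω => ?_)
  · exact (by fun_prop : Measurable _).aestronglyMeasurable
  · rw [Real.norm_eq_abs, Real.abs_exp]
    refine Real.exp_le_exp.2 (Finset.sum_le_sum fun i _ => Finset.sum_le_sum fun j _ => ?_)
    calc c i j * A ω i j ≤ |c i j * A ω i j| := le_abs_self _
      _ = |c i j| * |A ω i j| := abs_mul _ _
      _ ≤ |c i j| * 1 := by gcongr; exact hA.abs_le_one ω i j
      _ = _ := mul_one _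

/-- Moment generating function of a linear statistic of the adjacency matrix. The weights
`c i j` and `c j i` meet in the same edge, hence the factor `2` in the exponent. -/
theorem IsRandomAdjacency.integral_exp_le (hA : IsRandomAdjacency μ A P)
    (hP : ∀ i j, 0 ≤ P i j) (hPs : ∀ i j, P i j = P j i) (hPd : ∀ i, P i i = 0)
    (c : Fin n → Fin n → ℝ) :
    ∫ ω, Real.exp (∑ i, ∑ j, c i j * A ω i j) ∂μ ≤
      Real.exp ((1 / 2) * ∑ i, ∑ j, P i j * (Real.exp (2 * c i j) - 1)) := by
  set w : {e : Fin n × Fin n // e.1 < e.2} → ℝ := fun e => c e.1.1 e.1.2 + c e.1.2 e.1.1 with hw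
  have h1 : ∀ ω, ∑ i, ∑ j, c i j * A ω i j =
      ∑ e : {e : Fin n × Fin n // e.1 < e.2}, w e * A ω e.1.1 e.1.2 := by
    intro ω
    rw [sum_sum_eq_sum_edges _ fun i => by simp [hA.diag ω i]]
    refine Finset.sum_congr rfl fun e _ => ?_
    rw [hA.symm ω e.1.2 e.1.1]; simp only [hw]; ring
  have h2 : ∑ i, ∑ j, P i j * (Real.exp (2 * c i j) - 1) =
      ∑ e : {e : Fin n × Fin n // e.1 < e.2}, P e.1.1 e.1.2 *
        (Real.exp (2 * c e.1.1 e.1.2) - 1 + (Real.exp (2 * c e.1.2 e.1.1) - 1)) := by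
    rw [sum_sum_eq_sum_edges _ fun i => by simp [hPd i]]
    refine Finset.sum_congr rfl fun e _ => ?_
    rw [hPs e.1.2 e.1.1]; ring
  have hind : iIndepFun (fun (e : {e : Fin n × Fin n // e.1 < e.2}) ω =>
      w e * A ω e.1.1 e.1.2) μ :=
    hA.indep.comp (fun e x => w e * x) fun e => by fun_prop
  have hm := hA.measurable
  have h3 : ∫ ω, Real.exp (∑ i, ∑ j, c i j * A ω i j) ∂μ =
      ∏ e : {e : Fin n × Fin n // e.1 < e.2},
        ∫ ω, Real.exp (w e * A ω e.1.1 e.1.2) ∂μ := by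
    have := hind.mgf_sum (t := 1) (fun e => by fun_prop) Finset.univ
    simpa [mgf, h1, Finset.sum_apply] using this
  rw [h3, h2, Finset.mul_sum, Real.exp_sum]
  refine Finset.prod_le_prod (fun e _ => integral_nonneg fun ω => (Real.exp_pos _).le)
    fun e _ => ?_
  have h4 : ∀ ω, Real.exp (w e * A ω e.1.1 e.1.2) =
      1 + (Real.exp (w e) - 1) * A ω e.1.1 e.1.2 := by
    intro ω
    rcases hA.zero_or_one ω e.1.1 e.1.2 with h | h <;> simp [h]
  have hint : Integrable (fun ω => A ω e.1.1 e.1.2) μ :=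
    Integrable.of_bound (hm _ _).aestronglyMeasurable 1 (ae_of_all _ fun ω => by
      simpa using hA.abs_le_one ω _ _)
  simp only [h4]
  rw [integral_add (integrable_const _) (hint.const_mul _), integral_const_mul,
    hA.integral_edge e.2 (hP _ _)]
  simp only [integral_const, probReal_univ, smul_eq_mul, mul_one]
  have h5 : Real.exp (w e) ≤
      (Real.exp (2 * c e.1.1 e.1.2) + Real.exp (2 * c e.1.2 e.1.1)) / 2 := by
    have e1 : Real.exp (w e) = Real.exp (c e.1.1 e.1.2) * Real.exp (c e.1.2 e.1.1) := by
      rw [← Real.exp_add]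
    have e2 : ∀ x : ℝ, Real.exp (2 * x) = Real.exp x ^ 2 := by
      intro x; rw [← Real.exp_nat_mul]; norm_num
    rw [e1, e2, e2]
    nlinarith [sq_nonneg (Real.exp (c e.1.1 e.1.2) - Real.exp (c e.1.2 e.1.1))]
  have h6 := mul_le_mul_of_nonneg_left h5 (hP e.1.1 e.1.2)
  refine le_trans ?_ (Real.add_one_le_exp _)
  nlinarith

/-- Chernoff bound for a linear statistic of the adjacency matrix. -/
theorem IsRandomAdjacency.measure_ge_le (hA : IsRandomAdjacency μ A P)
    (hP : ∀ i j, 0 ≤ P i j) (hPs : ∀ i j, P i j = P j i) (hPd : ∀ i, P i i = 0)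
    (c : Fin n → Fin n → ℝ) (t : ℝ) :
    μ.real {ω | t ≤ ∑ i, ∑ j, c i j * A ω i j} ≤
      Real.exp (-t + (1 / 2) * ∑ i, ∑ j, P i j * (Real.exp (2 * c i j) - 1)) := by
  have h := measure_ge_le_exp_mul_mgf (μ := μ) (X := fun ω => ∑ i, ∑ j, c i j * A ω i j) t
    zero_le_one (by simpa using hA.integrable_exp c)
  refine h.trans ?_
  rw [Real.exp_add, mgf]
  simp only [one_mul, neg_mul]
  gcongr
  exact hA.integral_exp_le hP hPs hPd c

end

/-! ### Light pairs -/

section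

/-- The integer vectors of squared Euclidean norm at most `16 n`. After division by `4 √n` they
form a `1/4`-net of the unit ball. -/
def intNet (n : ℕ) : Finset (Fin n → ℤ) :=
  (Fintype.piFinset fun _ => Finset.Icc (-(16 * n : ℤ)) (16 * n)).filter
    fun v => ∑ i, v i ^ 2 ≤ 16 * n

theorem mem_intNet {n : ℕ} {v : Fin n → ℤ} : v ∈ intNet n ↔ ∑ i, v i ^ 2 ≤ 16 * (n : ℤ) := by
  simp only [intNet, Finset.mem_filter, Fintype.mem_piFinset, Finset.mem_Icc,
    and_iff_right_iff_imp]
  intro h i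
  have h1 : v i ^ 2 ≤ ∑ i, v i ^ 2 :=
    Finset.single_le_sum (fun j _ => sq_nonneg (v j)) (Finset.mem_univ i)
  have h2 : |v i| ≤ v i ^ 2 := by
    rw [← sq_abs, sq]
    rcases eq_or_ne (v i) 0 with h0 | h0
    · simp [h0]
    · nlinarith [Int.one_le_abs h0]
  exact abs_le.1 (by omega)

theorem sum_sq_le_of_mem_intNet {n : ℕ} {v : Fin n → ℤ} (hv : v ∈ intNet n) :
    ∑ i, (v i : ℝ) ^ 2 ≤ 16 * n := by
  exact_mod_cast mem_intNet.1 hv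

theorem neg_mem_intNet {n : ℕ} {v : Fin n → ℤ} (hv : v ∈ intNet n) : -v ∈ intNet n := by
  rw [mem_intNet] at hv ⊢
  simpa using hv

theorem sum_exp_neg_sq_le (b : ℕ) :
    ∑ j ∈ Finset.Icc (-(b : ℤ)) b, Real.exp (-(j : ℝ) ^ 2) ≤ 3 := by
  have key : ∑ j ∈ Finset.Icc (-(b : ℤ)) b, Real.exp (-(j : ℝ) ^ 2) ≤ 3 - 2 * (1 / 2) ^ b := by
    induction b with
    | zero => simp; norm_num
    | succ b ih =>
      have hs : Finset.Icc (-((b + 1 : ℕ) : ℤ)) ((b + 1 : ℕ) : ℤ) =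
          insert (-(b + 1 : ℤ)) (insert (b + 1 : ℤ) (Finset.Icc (-(b : ℤ)) b)) := by
        ext j; simp only [Finset.mem_Icc, Finset.mem_insert]; push_cast; omega
      have he : Real.exp (-((b : ℝ) + 1) ^ 2) ≤ (1 / 2) ^ (b + 1) := by
        have h1 : Real.exp (-1) ≤ 1 / 2 := by
          rw [Real.exp_neg, one_div]
          gcongr
          have := Real.add_one_le_exp (1 : ℝ); linarith
        calc Real.exp (-((b : ℝ) + 1) ^ 2) ≤ Real.exp (((b + 1 : ℕ) : ℝ) * (-1)) := by
              gcongr; push_cast; nlinarith [(Nat.cast_nonneg b : (0 : ℝ) ≤ b)]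
          _ = Real.exp (-1) ^ (b + 1) := Real.exp_nat_mul _ _
          _ ≤ _ := by gcongr
      rw [hs, Finset.sum_insert, Finset.sum_insert]
      · push_cast
        have e3 : (-(-((b : ℝ) + 1)) ^ 2) = -((b : ℝ) + 1) ^ 2 := by ring
        rw [e3]
        rw [pow_succ (1 / 2 : ℝ)] at he ⊢
        linarith
      · simp
      · simp only [Finset.mem_Icc, Finset.mem_insert]; omega
  have : (0 : ℝ) ≤ 2 * (1 / 2) ^ b := by positivity
  linarith

theorem card_intNet_le (n : ℕ) : ((intNet n).card : ℝ) ≤ Real.exp (18 * n) := by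
  have h1 : ((intNet n).card : ℝ) ≤
      ∑ v ∈ intNet n, Real.exp (16 * n) * ∏ i, Real.exp (-(v i : ℝ) ^ 2) := by
    rw [Finset.card_eq_sum_ones]
    push_cast
    refine Finset.sum_le_sum fun v hv => ?_
    rw [← Real.exp_sum, ← Real.exp_add]
    refine Real.one_le_exp ?_
    rw [Finset.sum_neg_distrib]
    linarith [sum_sq_le_of_mem_intNet hv]
  have h2 : ∑ v ∈ intNet n, Real.exp (16 * n) * ∏ i, Real.exp (-(v i : ℝ) ^ 2) ≤
      ∑ v ∈ Fintype.piFinset fun _ : Fin n => Finset.Icc (-(16 * n : ℤ)) (16 * n),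
        Real.exp (16 * n) * ∏ i, Real.exp (-(v i : ℝ) ^ 2) :=
    Finset.sum_le_sum_of_subset_of_nonneg (Finset.filter_subset _ _) fun v _ _ => by positivity
  have h3 := Finset.prod_univ_sum (fun _ : Fin n => Finset.Icc (-(16 * n : ℤ)) (16 * n))
    fun _ j => Real.exp (-(j : ℝ) ^ 2)
  rw [← Finset.mul_sum, ← Finset.mul_sum, ← h3] at h2
  rw [← Finset.mul_sum] at h1
  refine (h1.trans h2).trans ?_
  have h4 := sum_exp_neg_sq_le (16 * n)
  push_cast at h4
  have h5 : (3 : ℝ) ≤ Real.exp 2 := by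
    have := Real.add_one_le_exp (2 : ℝ); linarith
  calc Real.exp (16 * n) * ∏ _i : Fin n,
        ∑ j ∈ Finset.Icc (-(16 * n : ℤ)) (16 * n), Real.exp (-(j : ℝ) ^ 2)
      ≤ Real.exp (16 * n) * ∏ _i : Fin n, Real.exp 2 := by
        gcongr with i hi
        exact h4.trans h5
    _ = Real.exp (18 * n) := by
        rw [Finset.prod_const, Finset.card_univ, Fintype.card_fin, ← Real.exp_nat_mul,
          ← Real.exp_add]
        congr 1; ring

/-- The product `v i * w j`, cut off to `0` on the pairs where it exceeds `r`. -/
def lightWeight {n : ℕ} (r : ℝ) (v w : Fin n → ℤ) (i j : Fin n) : ℝ :=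
  if |(v i : ℝ) * w j| ≤ r then (v i : ℝ) * w j else 0

theorem lightWeight_sq_le {n : ℕ} (r : ℝ) (v w : Fin n → ℤ) (i j : Fin n) :
    lightWeight r v w i j ^ 2 ≤ (v i : ℝ) ^ 2 * (w j : ℝ) ^ 2 := by
  unfold lightWeight
  split_ifs
  · rw [mul_pow]
  · simpa using mul_nonneg (sq_nonneg (v i : ℝ)) (sq_nonneg (w j : ℝ))

theorem abs_lightWeight_le {n : ℕ} {r : ℝ} (hr : 0 ≤ r) (v w : Fin n → ℤ) (i j : Fin n) :
    |lightWeight r v w i j| ≤ r := by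
  unfold lightWeight
  split_ifs with h
  · exact h
  · simpa using hr

theorem lightWeight_neg {n : ℕ} (r : ℝ) (v w : Fin n → ℤ) (i j : Fin n) :
    lightWeight r (-v) w i j = -lightWeight r v w i j := by
  simp [lightWeight]
  split_ifs <;> simp

variable {n : ℕ} {Ω : Type u} [MeasurableSpace Ω] {μ : Measure Ω} [IsProbabilityMeasure μ]
  {A : Ω → Matrix (Fin n) (Fin n) ℝ} {P : Matrix (Fin n) (Fin n) ℝ}

theorem IsRandomAdjacency.measure_light_ge_le (hA : IsRandomAdjacency μ A P) {d : ℝ}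
    (hd : 0 < d) (hP : ∀ i j, 0 ≤ P i j) (hPd : ∀ i j, P i j ≤ d / n)
    (hPs : ∀ i j, P i j = P j i) (hP0 : ∀ i, P i i = 0) {v w : Fin n → ℤ}
    (hv : v ∈ intNet n) (hw : w ∈ intNet n) :
    μ.real {ω | 400 * n * √d ≤ ∑ i, ∑ j, lightWeight (√d) v w i j * (A ω i j - P i j)} ≤
      Real.exp (-(72 * n)) := by
  have hsd : 0 < √d := Real.sqrt_pos.2 hd
  have hsq : √d ^ 2 = d := Real.sq_sqrt hd.le
  -- the largest scaling for which all exponents `2 * c i j` are at most `1` in absolute value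
  set c : Fin n → Fin n → ℝ := fun i j => (2 * √d)⁻¹ * lightWeight (√d) v w i j with hc
  have hset : {ω | 400 * n * √d ≤ ∑ i, ∑ j, lightWeight (√d) v w i j * (A ω i j - P i j)} ⊆
      {ω | 200 * n + ∑ i, ∑ j, c i j * P i j ≤ ∑ i, ∑ j, c i j * A ω i j} := by
    intro ω hω
    simp only [Set.mem_ofPred_eq] at hω ⊢
    have e1 : ∑ i, ∑ j, c i j * A ω i j - ∑ i, ∑ j, c i j * P i j = (2 * √d)⁻¹ *
        ∑ i, ∑ j, lightWeight (√d) v w i j * (A ω i j - P i j) := by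
      simp only [← Finset.sum_sub_distrib, Finset.mul_sum, hc]
      refine Finset.sum_congr rfl fun i _ => Finset.sum_congr rfl fun j _ => by ring
    have e2 : (2 * √d)⁻¹ * (400 * n * √d) = 200 * n := by field_simp; ring
    have e3 := mul_le_mul_of_nonneg_left hω (inv_nonneg.2 (by positivity : 0 ≤ 2 * √d))
    linarith
  refine (measureReal_mono hset).trans ((hA.measure_ge_le hP hPs hP0 c _).trans ?_)
  gcongr
  have h1 : ∀ i j, P i j * (Real.exp (2 * c i j) - 1) ≤
      2 * (c i j * P i j) + (1 / n) * ((v i : ℝ) ^ 2 * (w j : ℝ) ^ 2) := by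
    intro i j
    have h2 : |2 * c i j| ≤ 1 := by
      have := abs_lightWeight_le hsd.le v w i j
      simp only [hc]
      rw [mul_inv, ← mul_assoc, ← mul_assoc, mul_inv_cancel₀ (by norm_num), one_mul, abs_mul,
        abs_of_pos (inv_pos.2 hsd), inv_mul_le_iff₀ hsd, mul_one]
      exact this
    have h3 := (abs_le.1 (Real.abs_exp_sub_one_sub_id_le h2)).2
    have h4 : (2 * c i j) ^ 2 = lightWeight (√d) v w i j ^ 2 / d := by
      simp only [hc]
      rw [← hsq]; field_simp; rw [Real.sqrt_sq hsd.le]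
    have h5 : P i j * (Real.exp (2 * c i j) - 1 - 2 * c i j) ≤
        d / n * (((v i : ℝ) ^ 2 * (w j : ℝ) ^ 2) / d) := by
      have h6 : Real.exp (2 * c i j) - 1 - 2 * c i j ≤ ((v i : ℝ) ^ 2 * (w j : ℝ) ^ 2) / d := by
        rw [h4] at h3
        exact h3.trans (by gcongr; exact lightWeight_sq_le _ _ _ _ _)
      exact (mul_le_mul_of_nonneg_left h6 (hP i j)).trans
        (mul_le_mul_of_nonneg_right (hPd i j) (by positivity))
    have h7 : d / n * (((v i : ℝ) ^ 2 * (w j : ℝ) ^ 2) / d) =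
        (1 / n) * ((v i : ℝ) ^ 2 * (w j : ℝ) ^ 2) := by field_simp
    linarith
  have h8 : ∑ i, ∑ j, P i j * (Real.exp (2 * c i j) - 1) ≤
      2 * ∑ i, ∑ j, c i j * P i j +
        (1 / n) * ((∑ i, (v i : ℝ) ^ 2) * ∑ j, (w j : ℝ) ^ 2) := by
    rw [Finset.sum_mul_sum]
    simp only [Finset.mul_sum, ← Finset.sum_add_distrib]
    exact Finset.sum_le_sum fun i _ => Finset.sum_le_sum fun j _ => h1 i j
  have h9 : (1 / (n : ℝ)) * ((∑ i, (v i : ℝ) ^ 2) * ∑ j, (w j : ℝ) ^ 2) ≤ 256 * n := by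
    have h10 : (∑ i, (v i : ℝ) ^ 2) * ∑ j, (w j : ℝ) ^ 2 ≤ (16 * n) * (16 * n) := by
      gcongr
      · exact sum_sq_le_of_mem_intNet hv
      · exact sum_sq_le_of_mem_intNet hw
    rcases Nat.eq_zero_or_pos n with h0 | h0
    · subst h0; simp
    · have : (0 : ℝ) < n := by exact_mod_cast h0
      calc _ ≤ (1 / (n : ℝ)) * ((16 * n) * (16 * n)) := by gcongr
        _ = 256 * n := by field_simp; norm_num
  linarith

/-- Concentration on the light pairs, uniformly over the net: the Chernoff exponent `72 n` beats
the entropy `2 * 18 n` of pairs of net points. -/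
theorem IsRandomAdjacency.measure_exists_light_le (hA : IsRandomAdjacency μ A P) {d : ℝ}
    (hd : 0 < d) (hP : ∀ i j, 0 ≤ P i j) (hPd : ∀ i j, P i j ≤ d / n)
    (hPs : ∀ i j, P i j = P j i) (hP0 : ∀ i, P i i = 0) :
    μ.real {ω | ∃ v ∈ intNet n, ∃ w ∈ intNet n,
      400 * n * √d < |∑ i, ∑ j, lightWeight (√d) v w i j * (A ω i j - P i j)|} ≤
      Real.exp (-(36 * n)) := by
  have hsub : {ω | ∃ v ∈ intNet n, ∃ w ∈ intNet n,
      400 * n * √d < |∑ i, ∑ j, lightWeight (√d) v w i j * (A ω i j - P i j)|} ⊆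
      ⋃ x ∈ intNet n ×ˢ intNet n,
        {ω | 400 * n * √d ≤ ∑ i, ∑ j, lightWeight (√d) x.1 x.2 i j * (A ω i j - P i j)} := by
    rintro ω ⟨v, hv, w, hw, h⟩
    simp only [Set.mem_iUnion]
    rcases lt_abs.1 h with h | h
    · exact ⟨(v, w), Finset.mk_mem_product hv hw, h.le⟩
    · refine ⟨(-v, w), Finset.mk_mem_product (neg_mem_intNet hv) hw, ?_⟩
      simp only [Set.mem_ofPred_eq, lightWeight_neg, neg_mul, Finset.sum_neg_distrib]
      exact h.le
  refine (measureReal_mono hsub (measure_ne_top _ _)).trans ((measureReal_biUnion_finset_le _ _).trans ?_)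
  calc _ ≤ ∑ x ∈ intNet n ×ˢ intNet n, Real.exp (-(72 * n)) :=
        Finset.sum_le_sum fun x hx => hA.measure_light_ge_le hd hP hPd hPs hP0
          (Finset.mem_product.1 hx).1 (Finset.mem_product.1 hx).2
    _ = (intNet n).card * (intNet n).card * Real.exp (-(72 * n)) := by
        rw [Finset.sum_const, Finset.card_product]; simp
    _ ≤ Real.exp (18 * n) * Real.exp (18 * n) * Real.exp (-(72 * n)) := by
        gcongr <;> exact card_intNet_le n
    _ = _ := by rw [← Real.exp_add, ← Real.exp_add]; congr 1; ring

end

/-! ### Discrepancy and high degrees -/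

section

/-- The upper bound `a (1 + log (n / a))` for the logarithm of the binomial coefficient
`n.choose a`. -/
def entropyBound (n a : ℕ) : ℝ := a * (1 + Real.log (n / a))

theorem choose_le_exp_entropyBound {n a : ℕ} (han : a ≤ n) :
    (n.choose a : ℝ) ≤ Real.exp (entropyBound n a) := by
  rcases Nat.eq_zero_or_pos a with h0 | h0
  · subst h0; simp [entropyBound]
  have ha : (0 : ℝ) < a := by exact_mod_cast h0
  have hn : (0 : ℝ) < n := by exact_mod_cast h0.trans_le han
  have h1 : (n.choose a : ℝ) ≤ (n : ℝ) ^ a / a.factorial := Nat.choose_le_pow_div a n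
  have h2 : (a : ℝ) ^ a / a.factorial ≤ Real.exp a := Real.pow_div_factorial_le_exp _ ha.le a
  have h3 : Real.exp (entropyBound n a) = Real.exp a * ((n : ℝ) / a) ^ a := by
    rw [entropyBound, mul_add, mul_one, Real.exp_add, Real.exp_nat_mul,
      Real.exp_log (by positivity)]
  rw [h3]
  calc (n.choose a : ℝ) ≤ (n : ℝ) ^ a / a.factorial := h1
    _ = (a : ℝ) ^ a / a.factorial * ((n : ℝ) / a) ^ a := by
        rw [div_pow]; field_simp
    _ ≤ _ := by gcongr

theorem one_add_log_le_entropyBound {n a : ℕ} (ha1 : 1 ≤ a) (han : a ≤ n) :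
    1 + Real.log n ≤ entropyBound n a := by
  have ha : (1 : ℝ) ≤ a := by exact_mod_cast ha1
  have hn : (a : ℝ) ≤ n := by exact_mod_cast han
  have h1 : Real.log a ≤ Real.log n := Real.log_le_log (by linarith) hn
  have h2 : Real.log a ≤ a - 1 := Real.log_le_sub_one_of_pos (by linarith)
  rw [entropyBound, Real.log_div (by linarith) (by linarith)]
  nlinarith [mul_nonneg (sub_nonneg.2 ha) (sub_nonneg.2 h1)]

theorem sum_exp_neg_entropyBound_le (n : ℕ) :
    ∑ I : Finset (Fin n), Real.exp (-entropyBound n I.card) ≤ n + 1 := by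
  have h := Finset.sum_powerset_apply_card (fun a => Real.exp (-entropyBound n a))
    (x := (Finset.univ : Finset (Fin n)))
  rw [Finset.powerset_univ, Finset.card_univ, Fintype.card_fin] at h
  rw [h]
  calc _ ≤ ∑ _a ∈ Finset.range (n + 1), (1 : ℝ) := by
        refine Finset.sum_le_sum fun a ha => ?_
        rw [nsmul_eq_mul, Real.exp_neg, ← div_eq_mul_inv, div_le_one (Real.exp_pos _)]
        exact choose_le_exp_entropyBound (Nat.lt_succ_iff.1 (Finset.mem_range.1 ha))
    _ = n + 1 := by simp

/-- The number of edges between `I` and `J`; an edge inside `I ∩ J` counts twice. -/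
def edgeSum {n : ℕ} (A : Matrix (Fin n) (Fin n) ℝ) (I J : Finset (Fin n)) : ℝ :=
  ∑ i ∈ I, ∑ j ∈ J, A i j

/-- The discrepancy property of a graph of density `d / n`: with `x` the quotient of the edge
count `e(I, J)` by its mean bound `|I| |J| d / n`, either `x ≤ e⁴`, or `e(I, J) log x` is at most
a multiple of the entropy of `I` or of that of `J`. -/
def HasDiscrepancy {n : ℕ} (d : ℝ) (A : Matrix (Fin n) (Fin n) ℝ) : Prop :=
  ∀ I J : Finset (Fin n), I.Nonempty → J.Nonempty →
    edgeSum A I J ≤ Real.exp 4 * (I.card * J.card * (d / n)) ∨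
    edgeSum A I J * Real.log (edgeSum A I J / (I.card * J.card * (d / n))) ≤
      64 * entropyBound n I.card ∨
    edgeSum A I J * Real.log (edgeSum A I J / (I.card * J.card * (d / n))) ≤
      64 * entropyBound n J.card

theorem sum_sum_ite_mem_mul {n : ℕ} (I J : Finset (Fin n)) (x : ℝ)
    (M : Matrix (Fin n) (Fin n) ℝ) :
    ∑ i, ∑ j, (if i ∈ I ∧ j ∈ J then x else 0) * M i j = x * ∑ i ∈ I, ∑ j ∈ J, M i j := by
  simp only [ite_mul, zero_mul, ite_and]
  rw [Finset.mul_sum, ← Finset.sum_filter_add_sum_filter_not Finset.univ (· ∈ I)]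
  rw [Finset.sum_eq_zero (s := Finset.univ.filter (· ∉ I)), add_zero]
  · rw [Finset.filter_mem_eq_inter, Finset.univ_inter]
    refine Finset.sum_congr rfl fun i hi => ?_
    simp [hi, Finset.mul_sum]
  · intro i hi
    simp [(Finset.mem_filter.1 hi).2]

variable {n : ℕ} {Ω : Type u} [MeasurableSpace Ω] {μ : Measure Ω}
  {A : Ω → Matrix (Fin n) (Fin n) ℝ} {P : Matrix (Fin n) (Fin n) ℝ}

theorem IsRandomAdjacency.exists_nat_edgeSum (hA : IsRandomAdjacency μ A P) (ω : Ω)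
    (I J : Finset (Fin n)) : ∃ m : ℕ, m ≤ n ^ 2 ∧ edgeSum (A ω) I J = m := by
  classical
  refine ⟨∑ i ∈ I, ∑ j ∈ J, if A ω i j = 1 then 1 else 0, ?_, ?_⟩
  · calc ∑ i ∈ I, ∑ j ∈ J, (if A ω i j = 1 then 1 else 0) ≤ ∑ _i ∈ I, ∑ _j ∈ J, 1 := by
          gcongr; split_ifs <;> simp
      _ = I.card * J.card := by simp
      _ ≤ n * n := by
          gcongr
          · simpa using Finset.card_le_univ I
          · simpa using Finset.card_le_univ J
      _ = n ^ 2 := (sq n).symm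
  · rw [edgeSum]
    push_cast
    refine Finset.sum_congr rfl fun i _ => Finset.sum_congr rfl fun j _ => ?_
    rcases hA.zero_or_one ω i j with h | h <;> simp [h]

variable [IsProbabilityMeasure μ]

theorem IsRandomAdjacency.measure_edgeSum_ge_le (hA : IsRandomAdjacency μ A P) {d : ℝ}
    (hP : ∀ i j, 0 ≤ P i j) (hPd : ∀ i j, P i j ≤ d / n)
    (hPs : ∀ i j, P i j = P j i) (hP0 : ∀ i, P i i = 0) (I J : Finset (Fin n)) {x : ℝ}
    (hx : 0 ≤ x) (t : ℝ) :
    μ.real {ω | t ≤ edgeSum (A ω) I J} ≤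
      Real.exp (-(x * t) + (1 / 2) * (I.card * J.card * (d / n) * (Real.exp (2 * x) - 1))) := by
  rcases hx.eq_or_lt with hx | hx
  · subst hx; simp
  have h := hA.measure_ge_le hP hPs hP0 (fun i j => if i ∈ I ∧ j ∈ J then x else 0) (x * t)
  simp only [sum_sum_ite_mem_mul, mul_le_mul_iff_right₀ hx] at h
  refine h.trans ?_
  gcongr
  have h1 : ∀ i j, P i j * (Real.exp (2 * if i ∈ I ∧ j ∈ J then x else 0) - 1) =
      (if i ∈ I ∧ j ∈ J then Real.exp (2 * x) - 1 else 0) * P i j := by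
    intro i j; split_ifs <;> simp [mul_comm]
  simp only [h1, sum_sum_ite_mem_mul]
  rw [mul_comm]
  have h2 : 0 ≤ Real.exp (2 * x) - 1 := by
    have := Real.one_le_exp (by linarith : 0 ≤ 2 * x); linarith
  gcongr
  calc ∑ i ∈ I, ∑ j ∈ J, P i j ≤ ∑ _i ∈ I, ∑ _j ∈ J, d / n := by
        gcongr; exact hPd _ _
    _ = _ := by simp; ring

/-- Chernoff bound in the large deviation regime, with the optimal exponent `log (t / mean) / 2`. -/
theorem IsRandomAdjacency.measure_edgeSum_ge_le_exp_log (hA : IsRandomAdjacency μ A P) {d : ℝ}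
    (hP : ∀ i j, 0 ≤ P i j) (hPd : ∀ i j, P i j ≤ d / n)
    (hPs : ∀ i j, P i j = P j i) (hP0 : ∀ i, P i i = 0) (I J : Finset (Fin n)) {t : ℝ}
    (hpos : 0 < I.card * J.card * (d / n)) (ht : Real.exp 4 * (I.card * J.card * (d / n)) < t) :
    μ.real {ω | t ≤ edgeSum (A ω) I J} ≤
      Real.exp (-(t * Real.log (t / (I.card * J.card * (d / n))) / 4)) := by
  set ν := I.card * J.card * (d / n) with hν
  have hr : Real.exp 4 < t / ν := by rwa [lt_div_iff₀ hpos]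
  have hr0 : 0 < t / ν := (Real.exp_pos 4).trans hr
  have hl : 4 < Real.log (t / ν) := by rwa [Real.lt_log_iff_exp_lt hr0]
  have ht0 : 0 < t := by
    have := mul_pos hr0 hpos
    rwa [div_mul_cancel₀ _ hpos.ne'] at this
  refine (hA.measure_edgeSum_ge_le hP hPd hPs hP0 I J (x := Real.log (t / ν) / 2)
    (by linarith) t).trans (Real.exp_le_exp.2 ?_)
  rw [← hν, show 2 * (Real.log (t / ν) / 2) = Real.log (t / ν) by ring, Real.exp_log hr0]
  have : ν * (t / ν - 1) = t - ν := by field_simp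
  rw [this]
  nlinarith

theorem IsRandomAdjacency.measure_not_hasDiscrepancy_le (hA : IsRandomAdjacency μ A P) {d : ℝ}
    (hn : 1 ≤ n) (hd : 0 < d) (hP : ∀ i j, 0 ≤ P i j) (hPd : ∀ i j, P i j ≤ d / n)
    (hPs : ∀ i j, P i j = P j i) (hP0 : ∀ i, P i i = 0) :
    μ.real {ω | ¬ HasDiscrepancy d (A ω)} ≤
      (n + 1) * (n + 1) * (n ^ 2 + 1) * Real.exp (-(14 * (1 + Real.log n))) := by
  classical
  have hn0 : (0 : ℝ) < n := by exact_mod_cast hn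
  set ν : Finset (Fin n) → Finset (Fin n) → ℝ := fun I J => I.card * J.card * (d / n) with hν
  -- edge sums are integers, so the union bound may run over their values as well; this replaces
  -- the inversion of `t ↦ t log (t / ν)`
  set good : Finset (Fin n) × Finset (Fin n) × ℕ → Prop := fun x =>
    x.1.Nonempty ∧ x.2.1.Nonempty ∧ Real.exp 4 * ν x.1 x.2.1 < x.2.2 ∧
      64 * entropyBound n x.1.card < x.2.2 * Real.log (x.2.2 / ν x.1 x.2.1) ∧
      64 * entropyBound n x.2.1.card < x.2.2 * Real.log (x.2.2 / ν x.1 x.2.1) with hgood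
  set F : Finset (Finset (Fin n) × Finset (Fin n) × ℕ) :=
    Finset.univ ×ˢ Finset.univ ×ˢ Finset.range (n ^ 2 + 1) with hF
  have hsub : {ω | ¬ HasDiscrepancy d (A ω)} ⊆
      ⋃ x ∈ F.filter good, {ω | (x.2.2 : ℝ) ≤ edgeSum (A ω) x.1 x.2.1} := by
    intro ω hω
    simp only [Set.mem_ofPred_eq, HasDiscrepancy] at hω
    push Not at hω
    obtain ⟨I, J, hI, hJ, h1, h2, h3⟩ := hω
    obtain ⟨m, hm, hmE⟩ := hA.exists_nat_edgeSum ω I J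
    rw [hmE] at h1 h2 h3
    simp only [Set.mem_iUnion]
    refine ⟨(I, J, m), Finset.mem_filter.2 ⟨?_, hI, hJ, h1, h2, h3⟩, hmE.ge⟩
    simp [hF]; omega
  refine (measureReal_mono hsub (measure_ne_top _ _)).trans
    ((measureReal_biUnion_finset_le _ _).trans ?_)
  have hterm : ∀ x ∈ F.filter good, μ.real {ω | (x.2.2 : ℝ) ≤ edgeSum (A ω) x.1 x.2.1} ≤
      Real.exp (-entropyBound n x.1.card) * (Real.exp (-entropyBound n x.2.1.card) *
        Real.exp (-(14 * (1 + Real.log n)))) := by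
    rintro ⟨I, J, m⟩ hx
    obtain ⟨hI, hJ, h1, h2, h3⟩ := (Finset.mem_filter.1 hx).2
    simp only at hI hJ h1 h2 h3 ⊢
    have hIc : (0 : ℝ) < I.card := by exact_mod_cast hI.card_pos
    have hJc : (0 : ℝ) < J.card := by exact_mod_cast hJ.card_pos
    refine (hA.measure_edgeSum_ge_le_exp_log hP hPd hPs hP0 I J (by positivity) h1).trans ?_
    rw [← Real.exp_add, ← Real.exp_add]
    refine Real.exp_le_exp.2 ?_
    have h4 := one_add_log_le_entropyBound (n := n) hI.card_pos (by simpa using I.card_le_univ)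
    have h5 := one_add_log_le_entropyBound (n := n) hJ.card_pos (by simpa using J.card_le_univ)
    simp only [hν] at h2 h3
    linarith
  refine (Finset.sum_le_sum hterm).trans ?_
  refine (Finset.sum_le_sum_of_subset_of_nonneg (Finset.filter_subset _ _)
    fun _ _ _ => by positivity).trans ?_
  rw [hF, Finset.sum_product]
  simp only [Finset.sum_product, Finset.sum_const, Finset.card_range, nsmul_eq_mul]
  have hS := sum_exp_neg_entropyBound_le n
  have hS0 : 0 ≤ ∑ I : Finset (Fin n), Real.exp (-entropyBound n I.card) :=
    Finset.sum_nonneg fun _ _ => (Real.exp_pos _).le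
  calc _ = (∑ I : Finset (Fin n), Real.exp (-entropyBound n I.card)) *
        (∑ I : Finset (Fin n), Real.exp (-entropyBound n I.card)) * (n ^ 2 + 1) *
          Real.exp (-(14 * (1 + Real.log n))) := by
        rw [Finset.sum_mul_sum]
        simp only [Finset.sum_mul]
        refine Finset.sum_congr rfl fun I _ => Finset.sum_congr rfl fun J _ => ?_
        push_cast; ring
    _ ≤ _ := by gcongr

/-- For `τ ≥ 12 d`, a set of `n / d` or more vertices of average degree at least `τ` is unlikely:
it would contain too many edge ends, and there are only `2 ^ n` sets. -/
theorem IsRandomAdjacency.measure_exists_heavy_set_le (hA : IsRandomAdjacency μ A P) {d τ : ℝ}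
    (hd : 0 < d) (hτ : 12 * d ≤ τ) (hP : ∀ i j, 0 ≤ P i j) (hPd : ∀ i j, P i j ≤ d / n)
    (hPs : ∀ i j, P i j = P j i) (hP0 : ∀ i, P i i = 0) :
    μ.real {ω | ∃ I : Finset (Fin n), (n : ℝ) ≤ I.card * d ∧
      τ * I.card ≤ edgeSum (A ω) I Finset.univ} ≤ Real.exp (-(7 * n)) := by
  classical
  set F : Finset (Finset (Fin n)) := Finset.univ.filter fun I => (n : ℝ) ≤ I.card * d with hF
  have hsub : {ω | ∃ I : Finset (Fin n), (n : ℝ) ≤ I.card * d ∧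
      τ * I.card ≤ edgeSum (A ω) I Finset.univ} ⊆
      ⋃ I ∈ F, {ω | τ * I.card ≤ edgeSum (A ω) I Finset.univ} := by
    rintro ω ⟨I, hI, h⟩
    simp only [Set.mem_iUnion]
    exact ⟨I, by simp [hF, hI], h⟩
  refine (measureReal_mono hsub (measure_ne_top _ _)).trans
    ((measureReal_biUnion_finset_le _ _).trans ?_)
  have hterm : ∀ I ∈ F, μ.real {ω | τ * I.card ≤ edgeSum (A ω) I Finset.univ} ≤
      Real.exp (-(8 * n)) := by
    intro I hI
    have hI' : (n : ℝ) ≤ I.card * d := (Finset.mem_filter.1 hI).2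
    refine (hA.measure_edgeSum_ge_le hP hPd hPs hP0 I Finset.univ zero_le_one _).trans
      (Real.exp_le_exp.2 ?_)
    have h1 : (I.card : ℝ) * (Finset.univ : Finset (Fin n)).card * (d / n) ≤ I.card * d := by
      rw [Finset.card_univ, Fintype.card_fin]
      rcases Nat.eq_zero_or_pos n with h0 | h0
      · subst h0; simp; positivity
      · have : (0 : ℝ) < n := by exact_mod_cast h0
        apply le_of_eq; field_simp
    have h2 : Real.exp (2 * 1) - 1 ≤ 8 := by
      have h3 := Real.exp_one_lt_d9
      have h4 : Real.exp (2 * 1) = Real.exp 1 * Real.exp 1 := by rw [← Real.exp_add]; norm_num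
      rw [h4]; nlinarith [Real.exp_pos 1]
    have h3 : 0 ≤ Real.exp (2 * 1) - 1 := by
      have := Real.one_le_exp (by norm_num : (0 : ℝ) ≤ 2 * 1); linarith
    have h5 : (0 : ℝ) ≤ I.card * d := by positivity
    have h4 : (I.card : ℝ) * (Finset.univ : Finset (Fin n)).card * (d / n) *
        (Real.exp (2 * 1) - 1) ≤ I.card * d * 8 := by
      gcongr
    have h6 : 12 * d * I.card ≤ τ * I.card := by gcongr
    nlinarith
  refine (Finset.sum_le_sum hterm).trans ?_
  rw [Finset.sum_const, nsmul_eq_mul]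
  have hc : (F.card : ℝ) ≤ Real.exp n := by
    have h1 : F.card ≤ 2 ^ n := by
      simpa using Finset.card_le_univ F
    have h2 : (2 : ℝ) ≤ Real.exp 1 := by
      have := Real.add_one_le_exp (1 : ℝ); linarith
    calc (F.card : ℝ) ≤ 2 ^ n := by exact_mod_cast h1
      _ ≤ Real.exp 1 ^ n := by gcongr
      _ = Real.exp n := by rw [← Real.exp_nat_mul, mul_one]
  calc _ ≤ Real.exp n * Real.exp (-(8 * n)) := by gcongr
    _ = _ := by rw [← Real.exp_add]; congr 1; ring

end

/-! ### Two dyadic levels -/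

section

theorem sum_pow_two_lt_le (N : ℕ) {x : ℝ} (hx : 0 ≤ x) :
    ∑ s ∈ Finset.range N, (if (2 : ℝ) ^ s < x then (2 : ℝ) ^ s else 0) ≤ 2 * x := by
  induction N with
  | zero => simpa using hx
  | succ N ih =>
    by_cases h : (2 : ℝ) ^ N < x
    · calc _ ≤ ∑ s ∈ Finset.range (N + 1), (2 : ℝ) ^ s := by
            refine Finset.sum_le_sum fun s _ => ?_
            split_ifs
            · exact le_rfl
            · positivity
        _ = 2 * 2 ^ N - 1 := by
            rw [geom_sum_eq (by norm_num), pow_succ]; ring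
        _ ≤ _ := by linarith
    · rw [Finset.sum_range_succ, if_neg h, add_zero]; exact ih

theorem sum_inv_pow_two_gt_le (N : ℕ) {y : ℝ} (hy : 0 < y) :
    ∑ t ∈ Finset.range N, (if y < (2 : ℝ) ^ t then ((2 : ℝ) ^ t)⁻¹ else 0) ≤ 2 / y := by
  induction N generalizing y with
  | zero => simp; positivity
  | succ N ih =>
    by_cases h : y < 1
    · have h2 : ∑ t ∈ Finset.range (N + 1), (1 / (2 : ℝ)) ^ t ≤ 2 := sum_geometric_two_le _
      calc _ ≤ ∑ t ∈ Finset.range (N + 1), (1 / (2 : ℝ)) ^ t := by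
            refine Finset.sum_le_sum fun t _ => ?_
            split_ifs
            · simp
            · positivity
        _ ≤ 2 := h2
        _ ≤ 2 / y := by rw [le_div_iff₀ hy]; linarith
    · rw [Finset.sum_range_succ', pow_zero, if_neg h, add_zero]
      have h3 := ih (half_pos hy)
      have h4 : ∀ t : ℕ, (if y < (2 : ℝ) ^ (t + 1) then ((2 : ℝ) ^ (t + 1))⁻¹ else 0) =
          1 / 2 * (if y / 2 < (2 : ℝ) ^ t then ((2 : ℝ) ^ t)⁻¹ else 0) := by
        intro t
        have : y < (2 : ℝ) ^ (t + 1) ↔ y / 2 < (2 : ℝ) ^ t := by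
          rw [pow_succ, div_lt_iff₀ (by norm_num)]
        simp only [this]
        split_ifs
        · rw [pow_succ, mul_inv]; ring
        · simp
      simp only [h4]
      rw [← Finset.mul_sum]
      calc _ ≤ 1 / 2 * (2 / (y / 2)) := by gcongr
        _ = 2 / y := by field_simp

/-- The bound for the contribution of two dyadic levels to the heavy sum: `a` and `b` are the sizes
of the levels, `X` and `Y` the magnitudes of the coordinates on them. -/
def levelBound (n d a b X Y : ℝ) : ℝ :=
  4 * Real.exp 4 * (√d / n * (a * X ^ 2) * (b * Y ^ 2)) + 320 * (b * Y ^ 2 * (X / Y)) +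
    64 * (b * Y ^ 2 * if X < √d then X else 0) + 4 * (a * X ^ 2 * (d / (X * Y)))

theorem levelBound_nonneg {n d a b X Y : ℝ} (hn : 0 ≤ n) (hd : 0 ≤ d) (ha : 0 ≤ a) (hb : 0 ≤ b)
    (hX : 0 ≤ X) (hY : 0 ≤ Y) : 0 ≤ levelBound n d a b X Y := by
  have : 0 ≤ if X < √d then X else 0 := by split_ifs <;> simp [hX]
  unfold levelBound
  positivity

/-- The discrepancy property bounds the number `E` of edges between two dyadic levels. With `x` the
quotient of `E` by its mean bound, the cases are: `x` bounded; `log x` comparable to `log (n / b)`;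
and `x` at most a small power of `n / b`, where `n / b = Y² * (n / (b Y²))` is dominated by one or
the other of these two factors. -/
theorem mul_edges_le_levelBound {n d a b X Y E : ℝ} (hn : 0 < n) (hd : 0 < d) (ha : 0 < a)
    (hb : 0 < b) (hX : 1 ≤ X) (hY : 1 ≤ Y) (hE : 0 ≤ E) (hbY : b * Y ^ 2 ≤ 16 * n)
    (hXY : √d < 4 * (X * Y))
    (h : E ≤ Real.exp 4 * (a * b * (d / n)) ∨
      E * Real.log (E / (a * b * (d / n))) ≤ 64 * (b * (1 + Real.log (n / b)))) :
    X * Y * E ≤ levelBound n d a b X Y := by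
  have hX0 : 0 < X := by linarith
  have hY0 : 0 < Y := by linarith
  have hsd : 0 < √d := Real.sqrt_pos.2 hd
  have hsq : √d * √d = d := Real.mul_self_sqrt hd.le
  have hite : 0 ≤ if X < √d then X else 0 := by split_ifs <;> simp [hX0.le]
  have p1 : 0 ≤ 4 * Real.exp 4 * (√d / n * (a * X ^ 2) * (b * Y ^ 2)) := by positivity
  have p2 : 0 ≤ 320 * (b * Y ^ 2 * (X / Y)) := by positivity
  have p3 : 0 ≤ 64 * (b * Y ^ 2 * if X < √d then X else 0) := by positivity
  have p4 : 0 ≤ 4 * (a * X ^ 2 * (d / (X * Y))) := by positivity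
  unfold levelBound
  set ν := a * b * (d / n) with hν
  have hν0 : 0 < ν := by positivity
  by_cases h1 : E ≤ Real.exp 4 * ν
  · have : X * Y * E ≤ 4 * Real.exp 4 * (√d / n * (a * X ^ 2) * (b * Y ^ 2)) := by
      calc X * Y * E ≤ X * Y * (Real.exp 4 * ν) := by gcongr
        _ = Real.exp 4 * (√d * √d * (X * Y * a * b / n)) := by rw [hsq, hν]; ring
        _ ≤ Real.exp 4 * (√d * (4 * (X * Y)) * (X * Y * a * b / n)) := by gcongr
        _ = _ := by ring
    linarith
  have h2 := h.resolve_left h1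
  rw [not_le] at h1
  set x := E / ν with hx
  have hEx : E = x * ν := by rw [hx, div_mul_cancel₀ _ hν0.ne']
  have hx4 : Real.exp 4 < x := by rwa [hx, lt_div_iff₀ hν0]
  have hx0 : 0 < x := (Real.exp_pos _).trans hx4
  have hl : 4 < Real.log x := by rwa [Real.lt_log_iff_exp_lt hx0]
  by_cases h3 : Real.log (n / b) ≤ 4 * Real.log x
  · have h4 : E ≤ 320 * b := by
      have h5 : E * Real.log x ≤ 320 * b * Real.log x := by nlinarith
      exact le_of_mul_le_mul_right h5 (by linarith)
    have : X * Y * E ≤ 320 * (b * Y ^ 2 * (X / Y)) := by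
      calc X * Y * E ≤ X * Y * (320 * b) := by gcongr
        _ = _ := by field_simp
    linarith
  rw [not_le] at h3
  by_cases h4 : n / (b * Y ^ 2) ≤ Y ^ 2
  · have h5 : n / b ≤ Y ^ 4 := by
      rw [div_le_iff₀ (by positivity)] at h4 ⊢
      linarith
    have h6 : Real.log (n / b) ≤ 4 * Real.log Y := by
      have := Real.log_le_log (by positivity) h5
      rwa [Real.log_pow] at this
    by_cases h7 : x * √d ≤ X * Y
    · have : X * Y * E ≤ 1 * (√d / n * (a * X ^ 2) * (b * Y ^ 2)) := by
        calc X * Y * E = X * Y * (x * √d) * (√d * (a * b) / n) := by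
              rw [hEx, hν]; linear_combination -(X * Y * x * a * b / n) * hsq
          _ ≤ X * Y * (X * Y) * (√d * (a * b) / n) := by gcongr
          _ = _ := by ring
      have p5 : 1 * (√d / n * (a * X ^ 2) * (b * Y ^ 2)) ≤
          4 * Real.exp 4 * (√d / n * (a * X ^ 2) * (b * Y ^ 2)) := by
        gcongr
        have := Real.one_le_exp (by norm_num : (0 : ℝ) ≤ 4)
        linarith
      linarith
    · have h8 : x < Y := (Real.log_lt_log_iff hx0 hY0).1 (by linarith)
      have h9 : X < √d := by
        rw [not_le] at h7
        have : X * Y < √d * Y := h7.trans (by rw [mul_comm]; gcongr)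
        exact lt_of_mul_lt_mul_right this hY0.le
      have h10 : Real.log Y ≤ Y - 1 := Real.log_le_sub_one_of_pos hY0
      have h11 : E ≤ 64 * b * Y := by nlinarith
      rw [if_pos h9]
      have : X * Y * E ≤ 64 * (b * Y ^ 2 * X) := by
        calc X * Y * E ≤ X * Y * (64 * b * Y) := by gcongr
          _ = _ := by ring
      have p3' : 0 ≤ 64 * (b * Y ^ 2 * X) := by positivity
      linarith
  · rw [not_le] at h4
    set ρ := n / (b * Y ^ 2) with hρ
    have hρ0 : 0 < ρ := by positivity
    have h5 : n / b < ρ ^ 2 := by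
      have : n / b = ρ * Y ^ 2 := by rw [hρ]; field_simp
      rw [this, pow_two ρ]; exact mul_lt_mul_of_pos_left h4 hρ0
    have h6 : x ^ 2 < ρ := by
      rw [← Real.log_lt_log_iff (by positivity) hρ0, Real.log_pow]
      have := Real.log_lt_log (by positivity) h5
      rw [Real.log_pow] at this
      push_cast at this ⊢
      linarith
    have h7 : x * (b * Y ^ 2) ≤ 4 * n := by
      refine le_of_sq_le_sq ?_ (by positivity)
      calc (x * (b * Y ^ 2)) ^ 2 = x ^ 2 * (b * Y ^ 2) ^ 2 := by ring
        _ ≤ ρ * (b * Y ^ 2) ^ 2 := by gcongr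
        _ = n * (b * Y ^ 2) := by rw [hρ]; field_simp
        _ ≤ n * (16 * n) := by gcongr
        _ = _ := by ring
    have : X * Y * E ≤ 4 * (a * X ^ 2 * (d / (X * Y))) := by
      calc X * Y * E = x * (b * Y ^ 2) * (a * X ^ 2 * (d / (X * Y)) / n) := by
            rw [hEx, hν]; field_simp
        _ ≤ 4 * n * (a * X ^ 2 * (d / (X * Y)) / n) := by gcongr
        _ = _ := by field_simp
    linarith

theorem sum_levelBound_le (N : ℕ) {n d : ℝ} (hn : 0 < n) (hd : 0 < d) {a b : ℕ → ℝ}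
    (ha : ∀ s, 0 ≤ a s) (hb : ∀ t, 0 ≤ b t)
    (has : ∑ s ∈ Finset.range N, a s * ((2 : ℝ) ^ s) ^ 2 ≤ 16 * n)
    (hbs : ∑ t ∈ Finset.range N, b t * ((2 : ℝ) ^ t) ^ 2 ≤ 16 * n) :
    ∑ s ∈ Finset.range N, ∑ t ∈ Finset.range N,
      (if √d < 4 * ((2 : ℝ) ^ s * 2 ^ t) ∧ (2 : ℝ) ^ s < 2 * √d * 2 ^ t then
        levelBound n d (a s) (b t) (2 ^ s) (2 ^ t) else 0) ≤
      (1024 * Real.exp 4 + 23040) * (n * √d) := by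
  have hsd : 0 < √d := Real.sqrt_pos.2 hd
  have hsq : √d * √d = d := Real.mul_self_sqrt hd.le
  set α : ℕ → ℝ := fun s => a s * ((2 : ℝ) ^ s) ^ 2 with hα
  set γ : ℕ → ℝ := fun t => b t * ((2 : ℝ) ^ t) ^ 2 with hγ
  have hα0 : ∀ s, 0 ≤ α s := fun s => mul_nonneg (ha s) (sq_nonneg _)
  have hγ0 : ∀ t, 0 ≤ γ t := fun t => mul_nonneg (hb t) (sq_nonneg _)
  set T1 : ℕ → ℕ → ℝ := fun s t => 4 * Real.exp 4 * (√d / n * α s * γ t) with hT1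
  set T2 : ℕ → ℕ → ℝ := fun s t => 320 * (γ t * ((2 : ℝ) ^ t)⁻¹ *
    if (2 : ℝ) ^ s < 2 * √d * 2 ^ t then (2 : ℝ) ^ s else 0) with hT2
  set T3 : ℕ → ℕ → ℝ := fun s t => 64 * (γ t * if (2 : ℝ) ^ s < √d then (2 : ℝ) ^ s else 0) with hT3
  set T4 : ℕ → ℕ → ℝ := fun s t => 4 * (α s * (d * ((2 : ℝ) ^ s)⁻¹) *
    if √d / (4 * 2 ^ s) < (2 : ℝ) ^ t then ((2 : ℝ) ^ t)⁻¹ else 0) with hT4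
  have hpt : ∀ s t, (if √d < 4 * ((2 : ℝ) ^ s * 2 ^ t) ∧ (2 : ℝ) ^ s < 2 * √d * 2 ^ t then
        levelBound n d (a s) (b t) (2 ^ s) (2 ^ t) else 0) ≤ T1 s t + T2 s t + T3 s t + T4 s t := by
    intro s t
    have q1 : 0 ≤ T1 s t := by have := hα0 s; have := hγ0 t; simp only [hT1]; positivity
    have q2 : 0 ≤ T2 s t := by
      have := hγ0 t; simp only [hT2]; split_ifs <;> positivity
    have q3 : 0 ≤ T3 s t := by
      have := hγ0 t; simp only [hT3]; split_ifs <;> positivity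
    have q4 : 0 ≤ T4 s t := by
      have := hα0 s; simp only [hT4]; split_ifs <;> positivity
    split_ifs with h
    · have h1 : √d / (4 * 2 ^ s) < (2 : ℝ) ^ t := by
        rw [div_lt_iff₀ (by positivity)]; linarith [h.1]
      apply le_of_eq
      simp only [levelBound, hT1, hT2, hT3, hT4, if_pos h.2, if_pos h1, hα, hγ]
      rw [div_eq_mul_inv, div_eq_mul_inv d, mul_inv]
      ring
    · linarith
  have hS1 : ∑ s ∈ Finset.range N, ∑ t ∈ Finset.range N, T1 s t ≤
      1024 * Real.exp 4 * (n * √d) := by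
    have : ∑ s ∈ Finset.range N, ∑ t ∈ Finset.range N, T1 s t = 4 * Real.exp 4 * (√d / n) *
        ((∑ s ∈ Finset.range N, α s) * ∑ t ∈ Finset.range N, γ t) := by
      rw [Finset.sum_mul_sum]
      simp only [Finset.mul_sum, hT1]
      exact Finset.sum_congr rfl fun s _ => Finset.sum_congr rfl fun t _ => by ring
    rw [this]
    calc _ ≤ 4 * Real.exp 4 * (√d / n) * ((16 * n) * (16 * n)) := by
          gcongr
          exact Finset.sum_nonneg fun t _ => hγ0 t
      _ = _ := by field_simp; norm_num
  have hS2 : ∑ s ∈ Finset.range N, ∑ t ∈ Finset.range N, T2 s t ≤ 20480 * (n * √d) := by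
    rw [Finset.sum_comm]
    calc _ ≤ ∑ t ∈ Finset.range N, 1280 * √d * γ t := by
          refine Finset.sum_le_sum fun t _ => ?_
          simp only [hT2]
          rw [← Finset.mul_sum, ← Finset.mul_sum]
          have h1 := sum_pow_two_lt_le N (x := 2 * √d * 2 ^ t) (by positivity)
          have := hγ0 t
          calc _ ≤ 320 * (γ t * ((2 : ℝ) ^ t)⁻¹ * (2 * (2 * √d * 2 ^ t))) := by gcongr
            _ = _ := by field_simp; ring
      _ = 1280 * √d * ∑ t ∈ Finset.range N, γ t := by rw [Finset.mul_sum]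
      _ ≤ 1280 * √d * (16 * n) := by gcongr
      _ = _ := by ring
  have hS3 : ∑ s ∈ Finset.range N, ∑ t ∈ Finset.range N, T3 s t ≤ 2048 * (n * √d) := by
    rw [Finset.sum_comm]
    calc _ ≤ ∑ t ∈ Finset.range N, 128 * √d * γ t := by
          refine Finset.sum_le_sum fun t _ => ?_
          simp only [hT3]
          rw [← Finset.mul_sum, ← Finset.mul_sum]
          have h1 := sum_pow_two_lt_le N hsd.le
          have := hγ0 t
          calc _ ≤ 64 * (γ t * (2 * √d)) := by gcongr
            _ = _ := by ring
      _ = 128 * √d * ∑ t ∈ Finset.range N, γ t := by rw [Finset.mul_sum]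
      _ ≤ 128 * √d * (16 * n) := by gcongr
      _ = _ := by ring
  have hS4 : ∑ s ∈ Finset.range N, ∑ t ∈ Finset.range N, T4 s t ≤ 512 * (n * √d) := by
    calc _ ≤ ∑ s ∈ Finset.range N, 32 * √d * α s := by
          refine Finset.sum_le_sum fun s _ => ?_
          simp only [hT4]
          rw [← Finset.mul_sum, ← Finset.mul_sum]
          have h1 := sum_inv_pow_two_gt_le N (y := √d / (4 * 2 ^ s)) (by positivity)
          have := hα0 s
          calc _ ≤ 4 * (α s * (d * ((2 : ℝ) ^ s)⁻¹) * (2 / (√d / (4 * 2 ^ s)))) := by gcongr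
            _ = _ := by field_simp; rw [Real.sq_sqrt hd.le]; ring
      _ = 32 * √d * ∑ s ∈ Finset.range N, α s := by rw [Finset.mul_sum]
      _ ≤ 32 * √d * (16 * n) := by gcongr
      _ = _ := by ring
  calc _ ≤ ∑ s ∈ Finset.range N, ∑ t ∈ Finset.range N, (T1 s t + T2 s t + T3 s t + T4 s t) :=
        Finset.sum_le_sum fun s _ => Finset.sum_le_sum fun t _ => hpt s t
    _ ≤ _ := by
        simp only [Finset.sum_add_distrib]
        linarith

end

/-! ### Heavy pairs -/

section

/-- The coordinates of `v` with `2 ^ s ≤ v i < 2 ^ (s + 1)`. -/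
def dyadicLevel {n : ℕ} (v : Fin n → ℕ) (s : ℕ) : Finset (Fin n) :=
  Finset.univ.filter fun i => v i ≠ 0 ∧ Nat.log 2 (v i) = s

theorem sum_eq_sum_dyadicLevel {n N : ℕ} (v : Fin n → ℕ) (hN : ∀ i, Nat.log 2 (v i) < N)
    (g : Fin n → ℝ) (hg : ∀ i, v i = 0 → g i = 0) :
    ∑ i, g i = ∑ s ∈ Finset.range N, ∑ i ∈ dyadicLevel v s, g i := by
  have h1 : ∑ i, g i = ∑ i ∈ Finset.univ.filter (fun i => v i ≠ 0), g i := by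
    rw [Finset.sum_filter]
    refine Finset.sum_congr rfl fun i _ => ?_
    split_ifs with h
    · rfl
    · exact hg i (not_not.1 h)
  rw [h1, ← Finset.sum_fiberwise_of_maps_to (t := Finset.range N) (g := fun i => Nat.log 2 (v i))
    fun i _ => Finset.mem_range.2 (hN i)]
  refine Finset.sum_congr rfl fun s _ => ?_
  rw [dyadicLevel, Finset.filter_filter]

theorem le_of_mem_dyadicLevel {n s : ℕ} {v : Fin n → ℕ} {i : Fin n} (h : i ∈ dyadicLevel v s) :
    (2 : ℝ) ^ s ≤ v i := by
  obtain ⟨h0, h1⟩ := (Finset.mem_filter.1 h).2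
  have := Nat.pow_log_le_self 2 h0
  rw [h1] at this
  exact_mod_cast this

theorem lt_of_mem_dyadicLevel {n s : ℕ} {v : Fin n → ℕ} {i : Fin n} (h : i ∈ dyadicLevel v s) :
    (v i : ℝ) < 2 * 2 ^ s := by
  obtain ⟨h0, h1⟩ := (Finset.mem_filter.1 h).2
  have := Nat.lt_pow_succ_log_self (b := 2) (by norm_num) (v i)
  rw [h1, pow_succ, mul_comm] at this
  exact_mod_cast this

theorem sum_card_dyadicLevel_le {n N : ℕ} (v : Fin n → ℕ) (hN : ∀ i, Nat.log 2 (v i) < N) :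
    ∑ s ∈ Finset.range N, ((dyadicLevel v s).card : ℝ) * ((2 : ℝ) ^ s) ^ 2 ≤
      ∑ i, (v i : ℝ) ^ 2 := by
  rw [sum_eq_sum_dyadicLevel v hN (fun i => (v i : ℝ) ^ 2) fun i hi => by simp [hi]]
  refine Finset.sum_le_sum fun s _ => ?_
  rw [← nsmul_eq_mul, ← Finset.sum_const]
  refine Finset.sum_le_sum fun i hi => ?_
  have := le_of_mem_dyadicLevel hi
  gcongr

theorem edgeSum_nonneg {n : ℕ} {A : Matrix (Fin n) (Fin n) ℝ} (hA : ∀ i j, 0 ≤ A i j)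
    (I J : Finset (Fin n)) : 0 ≤ edgeSum A I J :=
  Finset.sum_nonneg fun i _ => Finset.sum_nonneg fun j _ => hA i j

/-- The heavy pairs whose coordinates differ by a factor less than `√d`. Only here is the
discrepancy property used. -/
theorem sum_balanced_heavy_le {n : ℕ} (hn : 1 ≤ n) {d : ℝ} (hd : 0 < d)
    {A : Matrix (Fin n) (Fin n) ℝ} (hA : ∀ i j, 0 ≤ A i j) (hdisc : HasDiscrepancy d A)
    {v w : Fin n → ℕ} (hv : ∑ i, (v i : ℝ) ^ 2 ≤ 16 * n) (hw : ∑ j, (w j : ℝ) ^ 2 ≤ 16 * n) :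
    ∑ i, ∑ j, (if √d < (v i : ℝ) * w j ∧ (v i : ℝ) < √d * w j ∧ (w j : ℝ) < √d * v i then
      A i j * (v i * w j) else 0) ≤ 8 * (1024 * Real.exp 4 + 23040) * (n * √d) := by
  have hn0 : (0 : ℝ) < n := by exact_mod_cast hn
  have hsd : 0 < √d := Real.sqrt_pos.2 hd
  obtain ⟨N, hNv, hNw⟩ : ∃ N, (∀ i, Nat.log 2 (v i) < N) ∧ ∀ j, Nat.log 2 (w j) < N := by
    refine ⟨(∑ i, Nat.log 2 (v i)) + (∑ j, Nat.log 2 (w j)) + 1, fun i => ?_, fun j => ?_⟩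
    · have := Finset.single_le_sum (f := fun i => Nat.log 2 (v i)) (fun _ _ => Nat.zero_le _)
        (Finset.mem_univ i)
      omega
    · have := Finset.single_le_sum (f := fun i => Nat.log 2 (w i)) (fun _ _ => Nat.zero_le _)
        (Finset.mem_univ j)
      omega
  set I := dyadicLevel v with hI
  set J := dyadicLevel w with hJ
  have hav := (sum_card_dyadicLevel_le v hNv).trans hv
  have hbw := (sum_card_dyadicLevel_le w hNw).trans hw
  -- `F` and `G` bound a pair of levels through the entropy of the second and of the first level
  set F : ℕ → ℕ → ℝ := fun s t =>
    if √d < 4 * ((2 : ℝ) ^ s * 2 ^ t) ∧ (2 : ℝ) ^ s < 2 * √d * 2 ^ t then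
      levelBound n d (I s).card (J t).card (2 ^ s) (2 ^ t) else 0 with hF
  set G : ℕ → ℕ → ℝ := fun t s =>
    if √d < 4 * ((2 : ℝ) ^ t * 2 ^ s) ∧ (2 : ℝ) ^ t < 2 * √d * 2 ^ s then
      levelBound n d (J t).card (I s).card (2 ^ t) (2 ^ s) else 0 with hG
  have hF0 : ∀ s t, 0 ≤ F s t := fun s t => by
    simp only [hF]; split_ifs
    · apply levelBound_nonneg <;> positivity
    · exact le_rfl
  have hG0 : ∀ s t, 0 ≤ G s t := fun s t => by
    simp only [hG]; split_ifs
    · apply levelBound_nonneg <;> positivity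
    · exact le_rfl
  have hFs := sum_levelBound_le N hn0 hd (a := fun s => (I s).card) (b := fun t => (J t).card)
    (fun _ => by positivity) (fun _ => by positivity) hav hbw
  have hGs := sum_levelBound_le N hn0 hd (a := fun t => (J t).card) (b := fun s => (I s).card)
    (fun _ => by positivity) (fun _ => by positivity) hbw hav
  rw [Finset.sum_comm] at hGs
  have hcell : ∀ s ∈ Finset.range N, ∀ t ∈ Finset.range N, ∑ i ∈ I s, ∑ j ∈ J t,
      (if √d < (v i : ℝ) * w j ∧ (v i : ℝ) < √d * w j ∧ (w j : ℝ) < √d * v i then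
        A i j * (v i * w j) else 0) ≤ 4 * (F s t + G t s) := by
    intro s hs t ht
    have hR : 0 ≤ 4 * (F s t + G t s) := by linarith [hF0 s t, hG0 t s]
    by_cases hex : ∃ i ∈ I s, ∃ j ∈ J t,
        √d < (v i : ℝ) * w j ∧ (v i : ℝ) < √d * w j ∧ (w j : ℝ) < √d * v i
    · obtain ⟨i, hi, j, hj, h1, h2, h3⟩ := hex
      have i1 := le_of_mem_dyadicLevel hi
      have i2 := lt_of_mem_dyadicLevel hi
      have j1 := le_of_mem_dyadicLevel hj
      have j2 := lt_of_mem_dyadicLevel hj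
      have hx : (1 : ℝ) ≤ 2 ^ s := one_le_pow₀ (by norm_num)
      have hy : (1 : ℝ) ≤ 2 ^ t := one_le_pow₀ (by norm_num)
      have hXY : √d < 4 * ((2 : ℝ) ^ s * 2 ^ t) := by
        refine h1.trans_le ?_
        calc (v i : ℝ) * w j ≤ (2 * 2 ^ s) * (2 * 2 ^ t) := by gcongr
          _ = _ := by ring
      have hX : (2 : ℝ) ^ s < 2 * √d * 2 ^ t := by
        calc (2 : ℝ) ^ s ≤ v i := i1
          _ < √d * w j := h2
          _ ≤ √d * (2 * 2 ^ t) := by gcongr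
          _ = _ := by ring
      have hY : (2 : ℝ) ^ t < 2 * √d * 2 ^ s := by
        calc (2 : ℝ) ^ t ≤ w j := j1
          _ < √d * v i := h3
          _ ≤ √d * (2 * 2 ^ s) := by gcongr
          _ = _ := by ring
      have hsum : ∑ i ∈ I s, ∑ j ∈ J t,
          (if √d < (v i : ℝ) * w j ∧ (v i : ℝ) < √d * w j ∧ (w j : ℝ) < √d * v i then
            A i j * (v i * w j) else 0) ≤ 4 * (2 ^ s * 2 ^ t * edgeSum A (I s) (J t)) := by
        rw [edgeSum]
        simp only [Finset.mul_sum]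
        refine Finset.sum_le_sum fun i hi => Finset.sum_le_sum fun j hj => ?_
        have i2 := lt_of_mem_dyadicLevel hi
        have j2 := lt_of_mem_dyadicLevel hj
        have := hA i j
        split_ifs
        · calc A i j * ((v i : ℝ) * w j) ≤ A i j * ((2 * 2 ^ s) * (2 * 2 ^ t)) := by gcongr
            _ = _ := by ring
        · positivity
      refine hsum.trans ?_
      gcongr
      have hIc : (0 : ℝ) < (I s).card := by exact_mod_cast Finset.card_pos.2 ⟨i, hi⟩
      have hJc : (0 : ℝ) < (J t).card := by exact_mod_cast Finset.card_pos.2 ⟨j, hj⟩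
      have hE := edgeSum_nonneg hA (I s) (J t)
      have hIY : ((I s).card : ℝ) * ((2 : ℝ) ^ s) ^ 2 ≤ 16 * n :=
        (Finset.single_le_sum (f := fun s => ((I s).card : ℝ) * ((2 : ℝ) ^ s) ^ 2)
          (fun _ _ => by positivity) hs).trans hav
      have hJY : ((J t).card : ℝ) * ((2 : ℝ) ^ t) ^ 2 ≤ 16 * n :=
        (Finset.single_le_sum (f := fun s => ((J s).card : ℝ) * ((2 : ℝ) ^ s) ^ 2)
          (fun _ _ => by positivity) ht).trans hbw
      have hFe : F s t = levelBound n d (I s).card (J t).card (2 ^ s) (2 ^ t) := if_pos ⟨hXY, hX⟩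
      have hGe : G t s = levelBound n d (J t).card (I s).card (2 ^ t) (2 ^ s) :=
        if_pos ⟨by rwa [mul_comm ((2 : ℝ) ^ t)], hY⟩
      have hcase : 2 ^ s * 2 ^ t * edgeSum A (I s) (J t) ≤ F s t ∨
          2 ^ s * 2 ^ t * edgeSum A (I s) (J t) ≤ G t s := by
        rcases hdisc (I s) (J t) ⟨i, hi⟩ ⟨j, hj⟩ with h | h | h
        · left; rw [hFe]
          exact mul_edges_le_levelBound hn0 hd hIc hJc hx hy hE hJY hXY (Or.inl h)
        · right; rw [hGe, mul_comm ((2 : ℝ) ^ s)]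
          refine mul_edges_le_levelBound hn0 hd hJc hIc hy hx hE hIY
            (by rwa [mul_comm ((2 : ℝ) ^ t)]) (Or.inr ?_)
          rw [mul_comm ((J t).card : ℝ)]
          exact h
        · left; rw [hFe]
          exact mul_edges_le_levelBound hn0 hd hIc hJc hx hy hE hJY hXY (Or.inr h)
      rcases hcase with h | h
      · linarith [hG0 t s]
      · linarith [hF0 s t]
    · refine (Finset.sum_nonpos fun i hi => Finset.sum_nonpos fun j hj => ?_).trans hR
      rw [if_neg fun h => hex ⟨i, hi, j, hj, h⟩]
  calc _ = ∑ s ∈ Finset.range N, ∑ t ∈ Finset.range N, ∑ i ∈ I s, ∑ j ∈ J t,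
      (if √d < (v i : ℝ) * w j ∧ (v i : ℝ) < √d * w j ∧ (w j : ℝ) < √d * v i then
        A i j * (v i * w j) else 0) := by
        rw [sum_eq_sum_dyadicLevel v hNv _ fun i hi => by simp [hi]]
        refine Finset.sum_congr rfl fun s _ => ?_
        refine Finset.sum_comm.trans ?_
        rw [sum_eq_sum_dyadicLevel w hNw _ fun j hj => by simp [hj]]
        refine Finset.sum_congr rfl fun t _ => ?_
        rw [Finset.sum_comm]
    _ ≤ ∑ s ∈ Finset.range N, ∑ t ∈ Finset.range N, 4 * (F s t + G t s) :=
        Finset.sum_le_sum fun s hs => Finset.sum_le_sum fun t ht => hcell s hs t ht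
    _ ≤ _ := by
        simp only [← Finset.mul_sum, Finset.sum_add_distrib]
        linarith

/-- The heavy part of the bilinear form. Where one coordinate exceeds the other by a factor `√d`
the degree bound suffices. -/
theorem sum_heavy_le {n : ℕ} (hn : 1 ≤ n) {d c : ℝ} (hd : 0 < d) (hc : 0 ≤ c)
    {A : Matrix (Fin n) (Fin n) ℝ} (hA : ∀ i j, 0 ≤ A i j) (hsymm : ∀ i j, A i j = A j i)
    (hdisc : HasDiscrepancy d A) {v w : Fin n → ℕ} (hv : ∑ i, (v i : ℝ) ^ 2 ≤ 16 * n)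
    (hw : ∑ j, (w j : ℝ) ^ 2 ≤ 16 * n) (hvd : ∀ i, v i ≠ 0 → ∑ j, A i j ≤ c * d)
    (hwd : ∀ i, w i ≠ 0 → ∑ j, A i j ≤ c * d) :
    ∑ i, ∑ j, (if √d < (v i : ℝ) * w j then A i j * (v i * w j) else 0) ≤
      (32 * c + 8 * (1024 * Real.exp 4 + 23040)) * (n * √d) := by
  have hsd : 0 < √d := Real.sqrt_pos.2 hd
  have hsq : √d * √d = d := Real.mul_self_sqrt hd.le
  have hdeg : ∀ u : Fin n → ℕ, ∑ i, (u i : ℝ) ^ 2 ≤ 16 * n →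
      (∀ i, u i ≠ 0 → ∑ j, A i j ≤ c * d) →
      ∑ i, ∑ j, A i j * ((u i : ℝ) ^ 2 / √d) ≤ 16 * c * (n * √d) := by
    intro u hu hud
    calc ∑ i, ∑ j, A i j * ((u i : ℝ) ^ 2 / √d) ≤ ∑ i, c * √d * (u i : ℝ) ^ 2 := by
          refine Finset.sum_le_sum fun i _ => ?_
          rw [← Finset.sum_mul]
          by_cases h : u i = 0
          · simp [h]
          · calc (∑ j, A i j) * ((u i : ℝ) ^ 2 / √d) ≤ c * d * ((u i : ℝ) ^ 2 / √d) := by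
                  gcongr; exact hud i h
              _ = c * √d * (u i : ℝ) ^ 2 := by
                  field_simp; rw [Real.sq_sqrt hd.le]
      _ = c * √d * ∑ i, (u i : ℝ) ^ 2 := by rw [Finset.mul_sum]
      _ ≤ c * √d * (16 * n) := by gcongr
      _ = _ := by ring
  have h1 := hdeg v hv hvd
  have h2 := hdeg w hw hwd
  rw [Finset.sum_comm] at h2
  have h3 := sum_balanced_heavy_le hn hd hA hdisc hv hw
  have hpt : ∀ i j, (if √d < (v i : ℝ) * w j then A i j * ((v i : ℝ) * w j) else 0) ≤
      A i j * ((v i : ℝ) ^ 2 / √d) + A j i * ((w j : ℝ) ^ 2 / √d) +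
      if √d < (v i : ℝ) * w j ∧ (v i : ℝ) < √d * w j ∧ (w j : ℝ) < √d * v i then
        A i j * (v i * w j) else 0 := by
    intro i j
    have ha := hA i j
    have hb := hA j i
    have q1 : 0 ≤ A i j * ((v i : ℝ) ^ 2 / √d) := by positivity
    have q2 : 0 ≤ A j i * ((w j : ℝ) ^ 2 / √d) := by positivity
    have q3 : 0 ≤ if √d < (v i : ℝ) * w j ∧ (v i : ℝ) < √d * w j ∧ (w j : ℝ) < √d * v i then
        A i j * ((v i : ℝ) * w j) else 0 := by split_ifs <;> positivity
    by_cases g1 : √d < (v i : ℝ) * w j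
    swap
    · rw [if_neg g1]; linarith
    by_cases g2 : (v i : ℝ) < √d * w j
    swap
    · rw [if_pos g1]
      have : A i j * ((v i : ℝ) * w j) ≤ A i j * ((v i : ℝ) ^ 2 / √d) := by
        gcongr
        rw [le_div_iff₀ hsd]
        nlinarith [(Nat.cast_nonneg (v i) : (0 : ℝ) ≤ v i)]
      linarith
    by_cases g3 : (w j : ℝ) < √d * v i
    swap
    · rw [if_pos g1]
      have : A i j * ((v i : ℝ) * w j) ≤ A j i * ((w j : ℝ) ^ 2 / √d) := by
        rw [hsymm j i]
        gcongr
        rw [le_div_iff₀ hsd]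
        nlinarith [(Nat.cast_nonneg (w j) : (0 : ℝ) ≤ w j)]
      linarith
    rw [if_pos g1, if_pos ⟨g1, g2, g3⟩]
    linarith
  calc _ ≤ ∑ i, ∑ j, (A i j * ((v i : ℝ) ^ 2 / √d) + A j i * ((w j : ℝ) ^ 2 / √d) +
      if √d < (v i : ℝ) * w j ∧ (v i : ℝ) < √d * w j ∧ (w j : ℝ) < √d * v i then
        A i j * (v i * w j) else 0) :=
        Finset.sum_le_sum fun i _ => Finset.sum_le_sum fun j _ => hpt i j
    _ ≤ _ := by
        simp only [Finset.sum_add_distrib]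
        linarith

end

/-! ### Spectral norm from the net, and duality with low rank -/

section

open Matrix in
/-- `N` bounds the spectral norm of `M`, expressed through the bilinear form. -/
def BilinBound {n : ℕ} (M : Matrix (Fin n) (Fin n) ℝ) (N : ℝ) : Prop :=
  ∀ x y : Fin n → ℝ, ∑ i, x i ^ 2 ≤ 1 → ∑ j, y j ^ 2 ≤ 1 → |x ⬝ᵥ (M *ᵥ y)| ≤ N

theorem dotProduct_mulVec_eq_sum {n : ℕ} (M : Matrix (Fin n) (Fin n) ℝ) (x y : Fin n → ℝ) :
    x ⬝ᵥ (M.mulVec y) = ∑ i, ∑ j, x i * y j * M i j := by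
  simp only [dotProduct, Matrix.mulVec, Finset.mul_sum]
  exact Finset.sum_congr rfl fun i _ => Finset.sum_congr rfl fun j _ => by ring

theorem exists_int_abs_le_abs_sub_le (r : ℝ) : ∃ v : ℤ, |(v : ℝ)| ≤ |r| ∧ |r - v| ≤ 1 := by
  rcases le_total 0 r with h | h
  · refine ⟨⌊r⌋, ?_, ?_⟩
    · rw [abs_of_nonneg h, abs_of_nonneg (by exact_mod_cast Int.floor_nonneg.2 h)]
      exact Int.floor_le r
    · rw [abs_of_nonneg (sub_nonneg.2 (Int.floor_le r))]
      linarith [Int.lt_floor_add_one r]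
  · refine ⟨⌈r⌉, ?_, ?_⟩
    · have h1 : (⌈r⌉ : ℝ) ≤ 0 := by exact_mod_cast Int.ceil_le.2 (by simpa using h)
      rw [abs_of_nonpos h, abs_of_nonpos h1]
      linarith [Int.le_ceil r]
    · rw [abs_sub_comm, abs_of_nonneg (sub_nonneg.2 (Int.le_ceil r))]
      linarith [Int.ceil_lt_add_one r]

theorem exists_mem_intNet_near {n : ℕ} (hn : 1 ≤ n) (x : Fin n → ℝ) (hx : ∑ i, x i ^ 2 ≤ 1) :
    ∃ v ∈ intNet n, ∑ i, (4 * (x i - (4 * √n)⁻¹ * v i)) ^ 2 ≤ 1 := by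
  have hn0 : (0 : ℝ) < n := by exact_mod_cast hn
  have hs : 0 < √(n : ℝ) := Real.sqrt_pos.2 hn0
  have hsq : √(n : ℝ) ^ 2 = n := Real.sq_sqrt hn0.le
  choose v hv1 hv2 using fun i => exists_int_abs_le_abs_sub_le (4 * √n * x i)
  refine ⟨v, ?_, ?_⟩
  · rw [mem_intNet]
    have h : ∑ i, (v i : ℝ) ^ 2 ≤ 16 * n := by
      calc ∑ i, (v i : ℝ) ^ 2 ≤ ∑ i, (4 * √n * x i) ^ 2 :=
            Finset.sum_le_sum fun i _ => sq_le_sq.2 (hv1 i)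
        _ = 16 * n * ∑ i, x i ^ 2 := by
            rw [Finset.mul_sum]
            exact Finset.sum_congr rfl fun i _ => by rw [mul_pow, mul_pow, hsq]; norm_num
        _ ≤ 16 * n * 1 := by gcongr
        _ = _ := mul_one _
    exact_mod_cast h
  · calc _ ≤ ∑ _i : Fin n, (n : ℝ)⁻¹ := by
          refine Finset.sum_le_sum fun i _ => ?_
          have h1 : (4 * (x i - (4 * √n)⁻¹ * v i)) = (√n)⁻¹ * (4 * √n * x i - v i) := by
            field_simp
          rw [h1, mul_pow, inv_pow, hsq]
          have h2 : (4 * √n * x i - v i) ^ 2 ≤ 1 := by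
            rw [← sq_abs]; exact pow_le_one₀ (abs_nonneg _) (hv2 i)
          have : (0 : ℝ) ≤ (n : ℝ)⁻¹ := by positivity
          nlinarith
      _ = 1 := by simp [hn0.ne']

open Matrix in
/-- Passage from the net to the unit ball. If `N` bounds the form on the ball, so does
`B / 16 + N / 2`; hence the least bound is at most `B / 8`. -/
theorem bilinBound_of_intNet {n : ℕ} (hn : 1 ≤ n) (M : Matrix (Fin n) (Fin n) ℝ) {B : ℝ}
    (h : ∀ v ∈ intNet n, ∀ w ∈ intNet n,
      |(fun i => (v i : ℝ)) ⬝ᵥ (M *ᵥ fun j => (w j : ℝ))| ≤ B * n) :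
    BilinBound M (B / 8) := by
  have hn0 : (0 : ℝ) < n := by exact_mod_cast hn
  have hsq : √(n : ℝ) ^ 2 = n := Real.sq_sqrt hn0.le
  have hstep : ∀ N, BilinBound M N → BilinBound M (B / 16 + N / 2) := by
    intro N hN x y hx hy
    obtain ⟨v, hv, hxv⟩ := exists_mem_intNet_near hn x hx
    obtain ⟨w, hw, hyw⟩ := exists_mem_intNet_near hn y hy
    set a : ℝ := (4 * √n)⁻¹ with ha
    have ha2 : a ^ 2 * n = 1 / 16 := by
      rw [ha, inv_pow, mul_pow, hsq]; field_simp; norm_num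
    set x' : Fin n → ℝ := a • fun i => (v i : ℝ) with hx'
    set y' : Fin n → ℝ := a • fun j => (w j : ℝ) with hy'
    have hx'1 : ∑ i, x' i ^ 2 ≤ 1 := by
      have := sum_sq_le_of_mem_intNet hv
      calc ∑ i, x' i ^ 2 = a ^ 2 * ∑ i, (v i : ℝ) ^ 2 := by
            rw [Finset.mul_sum]; exact Finset.sum_congr rfl fun i _ => by simp [hx', mul_pow]
        _ ≤ a ^ 2 * (16 * n) := by gcongr
        _ = 1 := by linear_combination 16 * ha2
    have t1 : |x' ⬝ᵥ (M *ᵥ y')| ≤ B / 16 := by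
      rw [hx', hy', mulVec_smul, smul_dotProduct, dotProduct_smul, smul_eq_mul, smul_eq_mul,
        ← mul_assoc, ← sq, abs_mul, abs_of_nonneg (sq_nonneg a)]
      calc _ ≤ a ^ 2 * (B * n) := by gcongr; exact h v hv w hw
        _ = B / 16 := by linear_combination B * ha2
    have t2 : |x' ⬝ᵥ (M *ᵥ ((4 : ℝ) • (y - y')))| ≤ N :=
      hN _ _ hx'1 (by simpa [hy'] using hyw)
    have t3 : |((4 : ℝ) • (x - x')) ⬝ᵥ (M *ᵥ y)| ≤ N :=
      hN _ _ (by simpa [hx'] using hxv) hy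
    have e : x ⬝ᵥ (M *ᵥ y) = x' ⬝ᵥ (M *ᵥ y') + (x' ⬝ᵥ (M *ᵥ ((4 : ℝ) • (y - y')))) / 4 +
        (((4 : ℝ) • (x - x')) ⬝ᵥ (M *ᵥ y)) / 4 := by
      simp only [mulVec_smul, mulVec_sub, smul_dotProduct, dotProduct_smul, sub_dotProduct,
        dotProduct_sub, smul_eq_mul]
      ring
    rw [e]
    rw [abs_le] at *
    constructor <;> linarith [t1.1, t1.2, t2.1, t2.2, t3.1, t3.2]
  set V : Set ℝ := {N | BilinBound M N} with hV
  have hne : V.Nonempty := by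
    refine ⟨∑ i, ∑ j, |M i j|, fun x y hx hy => ?_⟩
    have hle : ∀ z : Fin n → ℝ, ∑ i, z i ^ 2 ≤ 1 → ∀ i, |z i| ≤ 1 := by
      intro z hz i
      have := (Finset.single_le_sum (f := fun i => z i ^ 2) (fun j _ => sq_nonneg (z j))
        (Finset.mem_univ i)).trans hz
      exact (sq_le_one_iff_abs_le_one _).1 this
    rw [dotProduct_mulVec_eq_sum]
    refine (Finset.abs_sum_le_sum_abs _ _).trans (Finset.sum_le_sum fun i _ =>
      (Finset.abs_sum_le_sum_abs _ _).trans (Finset.sum_le_sum fun j _ => ?_))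
    rw [abs_mul, abs_mul]
    have h1 := hle x hx i
    have h2 := hle y hy j
    calc |x i| * |y j| * |M i j| ≤ 1 * 1 * |M i j| := by gcongr
      _ = _ := by ring
  have hbdd : BddBelow V := by
    refine ⟨0, fun N hN => ?_⟩
    exact (abs_nonneg _).trans (hN 0 0 (by simp) (by simp))
  have h2 : sInf V ≤ B / 8 := by
    have : 2 * (sInf V - B / 16) ≤ sInf V := le_csInf hne fun N hN => by
      have := csInf_le hbdd (hstep N hN)
      linarith
    linarith
  intro x y hx hy
  exact (le_csInf hne fun N hN => hN x y hx hy).trans h2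

theorem BilinBound.nonneg {n : ℕ} {M : Matrix (Fin n) (Fin n) ℝ} {N : ℝ} (h : BilinBound M N) :
    0 ≤ N :=
  (abs_nonneg _).trans (h 0 0 (by simp) (by simp))

open Matrix in
theorem BilinBound.abs_dotProduct_le {n : ℕ} {M : Matrix (Fin n) (Fin n) ℝ} {N : ℝ}
    (h : BilinBound M N) {x : Fin n → ℝ} (hx : ∑ i, x i ^ 2 ≤ 1) (y : Fin n → ℝ) :
    |x ⬝ᵥ (M *ᵥ y)| ≤ N * √(∑ j, y j ^ 2) := by
  set r := √(∑ j, y j ^ 2) with hr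
  have hr2 : r ^ 2 = ∑ j, y j ^ 2 := Real.sq_sqrt (Finset.sum_nonneg fun j _ => sq_nonneg _)
  rcases (Real.sqrt_nonneg (∑ j, y j ^ 2)).eq_or_lt with h0 | h0
  · have hy : y = 0 := by
      rw [← hr, eq_comm] at h0
      rw [h0] at hr2
      funext j
      have := (Finset.sum_eq_zero_iff_of_nonneg (fun j _ => sq_nonneg (y j))).1
        (by rw [← hr2]; norm_num) j (Finset.mem_univ j)
      simpa using this
    rw [hy]; simp
    exact mul_nonneg h.nonneg (Real.sqrt_nonneg _)
  · rw [← hr] at h0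
    have h1 := h x (r⁻¹ • y) hx (by
      simp only [Pi.smul_apply, smul_eq_mul, mul_pow, ← Finset.mul_sum, ← hr2]
      rw [← mul_pow, inv_mul_cancel₀ h0.ne']; norm_num)
    rw [mulVec_smul, dotProduct_smul, smul_eq_mul, abs_mul, abs_of_pos (inv_pos.2 h0),
      inv_mul_le_iff₀ h0] at h1
    linarith

open Matrix in
/-- Duality of the spectral and the nuclear norm, for a matrix of rank at most `r`. -/
theorem BilinBound.abs_sum_mul_le {n r : ℕ} {M X : Matrix (Fin n) (Fin n) ℝ} {N : ℝ}
    (h : BilinBound M N) (hX : X.rank ≤ r) :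
    |∑ i, ∑ j, X i j * M i j| ≤ N * (√r * √(frobSq X)) := by
  set e := (WithLp.linearEquiv 2 ℝ (Fin n → ℝ)).symm with he
  set W := Submodule.span ℝ (Set.range X.col) with hW
  set U : Submodule ℝ (EuclideanSpace ℝ (Fin n)) := W.map (e : (Fin n → ℝ) →ₗ[ℝ] _) with hU
  have hfin : Module.finrank ℝ U = X.rank := by
    rw [rank_eq_finrank_span_cols]
    exact LinearEquiv.finrank_map_eq e W
  set b := stdOrthonormalBasis ℝ U with hb
  have hmem : ∀ j, e (X.col j) ∈ U := fun j =>
    Submodule.mem_map_of_mem (Submodule.subset_span (Set.mem_range_self j))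
  set c : Fin (Module.finrank ℝ U) → Fin n → ℝ :=
    fun a j => inner ℝ (b a) (⟨e (X.col j), hmem j⟩ : U) with hc
  set f : Fin (Module.finrank ℝ U) → Fin n → ℝ :=
    fun a i => (b a : EuclideanSpace ℝ (Fin n)) i with hf
  have hexp : ∀ i j, X i j = ∑ a, f a i * c a j := by
    intro i j
    have h1 := b.sum_repr' (⟨e (X.col j), hmem j⟩ : U)
    have h2 := congrArg (fun x : U => (x : EuclideanSpace ℝ (Fin n)) i) h1
    simp only [Submodule.coe_sum, Submodule.coe_smul] at h2
    rw [show X i j = (e (X.col j) : EuclideanSpace ℝ (Fin n)) i from rfl, ← h2]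
    simp [hf, hc, mul_comm]
  have hf1 : ∀ a, ∑ i, f a i ^ 2 ≤ 1 := by
    intro a
    have h1 : ‖(b a : EuclideanSpace ℝ (Fin n))‖ = 1 := b.norm_eq_one a
    have h2 := EuclideanSpace.norm_sq_eq (b a : EuclideanSpace ℝ (Fin n))
    rw [h1] at h2
    simp only [Real.norm_eq_abs, sq_abs] at h2
    simp only [hf]; linarith
  have hc2 : ∑ a, ∑ j, c a j ^ 2 = frobSq X := by
    rw [Finset.sum_comm, frobSq, Finset.sum_comm (f := fun i j => X i j ^ 2)]
    refine Finset.sum_congr rfl fun j _ => ?_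
    have h1 := b.sum_sq_norm_inner_right (⟨e (X.col j), hmem j⟩ : U)
    have h2 := EuclideanSpace.norm_sq_eq (e (X.col j))
    simp only [Real.norm_eq_abs, sq_abs] at h1 h2
    rw [show ∑ i, X i j ^ 2 = ∑ i, (e (X.col j)) i ^ 2 from rfl, ← h2]
    simpa [hc] using h1
  have hsum : ∑ i, ∑ j, X i j * M i j = ∑ a, f a ⬝ᵥ (M *ᵥ c a) := by
    simp only [dotProduct_mulVec_eq_sum]
    rw [Finset.sum_comm]
    simp only [hexp, Finset.sum_mul]
    rw [Finset.sum_comm]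
    refine Eq.trans ?_ (Finset.sum_comm.trans (Finset.sum_congr rfl fun a _ => rfl))
    refine Finset.sum_congr rfl fun i _ => ?_
    exact Finset.sum_comm
  rw [hsum]
  calc |∑ a, f a ⬝ᵥ (M *ᵥ c a)| ≤ ∑ a, |f a ⬝ᵥ (M *ᵥ c a)| := Finset.abs_sum_le_sum_abs _ _
    _ ≤ ∑ a, N * √(∑ j, c a j ^ 2) :=
        Finset.sum_le_sum fun a _ => h.abs_dotProduct_le (hf1 a) (c a)
    _ = N * ∑ a, 1 * √(∑ j, c a j ^ 2) := by simp [Finset.mul_sum]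
    _ ≤ N * (√(∑ _a : Fin (Module.finrank ℝ U), (1 : ℝ) ^ 2) *
          √(∑ a, √(∑ j, c a j ^ 2) ^ 2)) := by
        gcongr
        · exact h.nonneg
        · exact Real.sum_mul_le_sqrt_mul_sqrt _ _ _
    _ = N * (√(X.rank) * √(frobSq X)) := by
        congr 3
        · simp [hfin]
        · rw [← hc2]
          exact Finset.sum_congr rfl fun a _ =>
            Real.sq_sqrt (Finset.sum_nonneg fun j _ => sq_nonneg _)
    _ ≤ _ := by
        have := h.nonneg
        gcongr

end

/-! ### The trimmed matrix and its best low-rank approximation -/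

section

/-- The constant in the spectral norm bound, for degrees at most `c d`. -/
def spectralConst (c : ℝ) : ℝ := 656 + 32 * c + 8 * (1024 * Real.exp 4 + 23040)

theorem abs_sum_intNet_le {n : ℕ} (hn : 1 ≤ n) {d c : ℝ} (hd : 0 < d) (hc : 0 ≤ c)
    {A P : Matrix (Fin n) (Fin n) ℝ} (hA : ∀ i j, 0 ≤ A i j) (hsymm : ∀ i j, A i j = A j i)
    (hP : ∀ i j, 0 ≤ P i j) (hPd : ∀ i j, P i j ≤ d / n) (hdisc : HasDiscrepancy d A)
    (hlight : ∀ v ∈ intNet n, ∀ w ∈ intNet n,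
      |∑ i, ∑ j, lightWeight (√d) v w i j * (A i j - P i j)| ≤ 400 * n * √d)
    {v w : Fin n → ℤ} (hv : v ∈ intNet n) (hw : w ∈ intNet n)
    (hvd : ∀ i, v i ≠ 0 → ∑ j, A i j ≤ c * d) (hwd : ∀ i, w i ≠ 0 → ∑ j, A i j ≤ c * d) :
    |∑ i, ∑ j, (v i : ℝ) * w j * (A i j - P i j)| ≤ spectralConst c * √d * n := by
  have hn0 : (0 : ℝ) < n := by exact_mod_cast hn
  have hsd : 0 < √d := Real.sqrt_pos.2 hd
  have hcast : ∀ (u : Fin n → ℤ) i, (((u i).natAbs : ℕ) : ℝ) = |(u i : ℝ)| := fun u i => by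
    rw [Nat.cast_natAbs, Int.cast_abs]
  have hheavy := sum_heavy_le hn hd hc hA hsymm hdisc (v := fun i => (v i).natAbs)
    (w := fun i => (w i).natAbs) (by simpa [hcast] using sum_sq_le_of_mem_intNet hv)
    (by simpa [hcast] using sum_sq_le_of_mem_intNet hw)
    (fun i hi => hvd i (by simpa using hi)) (fun i hi => hwd i (by simpa using hi))
  simp only [hcast] at hheavy
  have hPh : ∑ i, ∑ j, (if √d < |(v i : ℝ)| * |(w j : ℝ)| then
      P i j * (|(v i : ℝ)| * |(w j : ℝ)|) else 0) ≤ 256 * (n * √d) := by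
    calc _ ≤ ∑ i, ∑ j, √d / n * ((v i : ℝ) ^ 2 * (w j : ℝ) ^ 2) := by
          refine Finset.sum_le_sum fun i _ => Finset.sum_le_sum fun j _ => ?_
          split_ifs with h
          · set y := |(v i : ℝ)| * |(w j : ℝ)| with hy
            have hy2 : (v i : ℝ) ^ 2 * (w j : ℝ) ^ 2 = y * y := by
              rw [← sq_abs (v i : ℝ), ← sq_abs (w j : ℝ), hy]; ring
            have hy0 : 0 ≤ y := by positivity
            rw [hy2]
            calc P i j * y ≤ d / n * y := by gcongr; exact hPd i j
              _ = √d / n * (√d * y) := by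
                  linear_combination -(y / n) * Real.mul_self_sqrt hd.le
              _ ≤ √d / n * (y * y) := by gcongr
          · positivity
      _ = √d / n * ((∑ i, (v i : ℝ) ^ 2) * ∑ j, (w j : ℝ) ^ 2) := by
          rw [Finset.sum_mul_sum]; simp only [Finset.mul_sum]
      _ ≤ √d / n * ((16 * n) * (16 * n)) := by
          gcongr
          · exact sum_sq_le_of_mem_intNet hv
          · exact sum_sq_le_of_mem_intNet hw
      _ = _ := by field_simp; norm_num
  have hpt : ∀ i j, |(v i : ℝ) * w j * (A i j - P i j) -
      lightWeight (√d) v w i j * (A i j - P i j)| ≤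
      (if √d < |(v i : ℝ)| * |(w j : ℝ)| then A i j * (|(v i : ℝ)| * |(w j : ℝ)|) else 0) +
      if √d < |(v i : ℝ)| * |(w j : ℝ)| then P i j * (|(v i : ℝ)| * |(w j : ℝ)|) else 0 := by
    intro i j
    rw [← abs_mul]
    unfold lightWeight
    by_cases h : |(v i : ℝ) * w j| ≤ √d
    · rw [if_pos h, if_neg h.not_gt, if_neg h.not_gt, sub_self, abs_zero, add_zero]
    · rw [if_neg h, zero_mul, sub_zero, if_pos (not_le.1 h), if_pos (not_le.1 h), ← add_mul,
        abs_mul, mul_comm]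
      gcongr
      rw [abs_le]
      constructor <;> linarith [hA i j, hP i j]
  have hsplit : ∑ i, ∑ j, (v i : ℝ) * w j * (A i j - P i j) =
      ∑ i, ∑ j, lightWeight (√d) v w i j * (A i j - P i j) +
      ∑ i, ∑ j, ((v i : ℝ) * w j * (A i j - P i j) -
        lightWeight (√d) v w i j * (A i j - P i j)) := by
    simp only [← Finset.sum_add_distrib]
    refine Finset.sum_congr rfl fun i _ => Finset.sum_congr rfl fun j _ => by ring
  have hrest : |∑ i, ∑ j, ((v i : ℝ) * w j * (A i j - P i j) -
        lightWeight (√d) v w i j * (A i j - P i j))| ≤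
      (32 * c + 8 * (1024 * Real.exp 4 + 23040)) * (n * √d) + 256 * (n * √d) := by
    refine (Finset.abs_sum_le_sum_abs _ _).trans ((Finset.sum_le_sum fun i _ =>
      (Finset.abs_sum_le_sum_abs _ _).trans (Finset.sum_le_sum fun j _ => hpt i j)).trans ?_)
    simp only [Finset.sum_add_distrib]
    linarith
  rw [hsplit]
  refine (abs_add_le _ _).trans ((add_le_add (hlight v hv w hw) hrest).trans ?_)
  unfold spectralConst
  apply le_of_eq; ring

/-- The matrix `M` with the rows and columns of the vertices whose degree exceeds `τ` set to
zero, so that `trim τ A = cutMatrix τ A A`. -/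
def cutMatrix {n : ℕ} (τ : ℝ) (A M : Matrix (Fin n) (Fin n) ℝ) : Matrix (Fin n) (Fin n) ℝ :=
  Matrix.of fun i j => if τ < ∑ l, A i l ∨ τ < ∑ l, A j l then 0 else M i j

/-- The spectral norm of the trimmed and centred adjacency matrix is of order `√d`. Trimming acts
on the net by deleting coordinates, so no union bound over the trimmed vertices is needed. -/
theorem bilinBound_cutMatrix {n : ℕ} (hn : 1 ≤ n) {d c τ : ℝ} (hd : 0 < d) (hc : 0 ≤ c)
    (hτ : τ ≤ c * d)
    {A P : Matrix (Fin n) (Fin n) ℝ} (hA : ∀ i j, 0 ≤ A i j) (hsymm : ∀ i j, A i j = A j i)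
    (hP : ∀ i j, 0 ≤ P i j) (hPd : ∀ i j, P i j ≤ d / n) (hdisc : HasDiscrepancy d A)
    (hlight : ∀ v ∈ intNet n, ∀ w ∈ intNet n,
      |∑ i, ∑ j, lightWeight (√d) v w i j * (A i j - P i j)| ≤ 400 * n * √d) :
    BilinBound (cutMatrix τ A (A - P)) (spectralConst c * √d / 8) := by
  refine bilinBound_of_intNet hn _ fun v hv w hw => ?_
  set cut : (Fin n → ℤ) → Fin n → ℤ := fun u i => if τ < ∑ l, A i l then 0 else u i with hcut
  have hmem : ∀ u ∈ intNet n, cut u ∈ intNet n := by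
    intro u hu
    rw [mem_intNet] at hu ⊢
    refine (Finset.sum_le_sum fun i _ => ?_).trans hu
    simp only [hcut]
    split_ifs
    · simpa using sq_nonneg (u i)
    · exact le_rfl
  have hdeg : ∀ u i, cut u i ≠ 0 → ∑ j, A i j ≤ c * d := by
    intro u i h
    by_contra h1
    exact h (if_pos (lt_of_le_of_lt hτ (not_le.1 h1)))
  have := abs_sum_intNet_le hn hd hc hA hsymm hP hPd hdisc hlight (hmem v hv) (hmem w hw)
    (hdeg v) (hdeg w)
  rw [dotProduct_mulVec_eq_sum]
  convert this using 4 with i _ j _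
  simp only [cutMatrix, hcut, Matrix.of_apply, Matrix.sub_apply]
  by_cases h1 : τ < ∑ l, A i l <;> by_cases h2 : τ < ∑ l, A j l <;> simp [h1, h2]

theorem frobSq_nonneg {n : ℕ} (X : Matrix (Fin n) (Fin n) ℝ) : 0 ≤ frobSq X :=
  Finset.sum_nonneg fun _ _ => Finset.sum_nonneg fun _ _ => sq_nonneg _

theorem abs_sum_mul_le_sqrt_frobSq {n : ℕ} (X Y : Matrix (Fin n) (Fin n) ℝ) :
    |∑ i, ∑ j, X i j * Y i j| ≤ √(frobSq X) * √(frobSq Y) := by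
  have h := Finset.sum_mul_sq_le_sq_mul_sq (Finset.univ : Finset (Fin n × Fin n))
    (fun e => X e.1 e.2) fun e => Y e.1 e.2
  simp only [← Finset.univ_product_univ, Finset.sum_product] at h
  rw [← Real.sqrt_mul (frobSq_nonneg X)]
  exact Real.abs_le_sqrt h

theorem rank_sub_le {n : ℕ} (X Y : Matrix (Fin n) (Fin n) ℝ) :
    (X - Y).rank ≤ X.rank + Y.rank := by
  have h : LinearMap.range (X - Y).mulVecLin ≤
      LinearMap.range X.mulVecLin ⊔ LinearMap.range Y.mulVecLin := by
    rintro _ ⟨v, rfl⟩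
    simp only [Matrix.mulVecLin_apply, Matrix.sub_mulVec]
    exact Submodule.sub_mem _ (Submodule.mem_sup_left ⟨v, rfl⟩) (Submodule.mem_sup_right ⟨v, rfl⟩)
  exact (Submodule.finrank_mono h).trans (Submodule.finrank_add_le_finrank_add_finrank _ _)

/-- Recovery of a low-rank matrix `Q` from a perturbation `T = Q + W + R`, with `W` small in
spectral and `R` in Frobenius norm. Optimality gives `‖X‖² ≤ 2 ⟨X, T - Q⟩` for the error `X`,
whose rank is at most `2 k`; the singular values of `T` do not enter. -/
theorem IsBestLowRank.sqrt_frobSq_sub_le {n k : ℕ} {T Phat Q W : Matrix (Fin n) (Fin n) ℝ} {N : ℝ}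
    (h : IsBestLowRank k T Phat) (hQ : Q.rank ≤ k) (hW : BilinBound W N) :
    √(frobSq (Phat - Q)) ≤ 2 * (N * √(2 * k : ℕ) + √(frobSq (T - Q - W))) := by
  set X := Phat - Q with hX
  have h1 : frobSq X ≤ 2 * ∑ i, ∑ j, X i j * (T - Q) i j := by
    have h2 := h.2 Q hQ
    have h3 : frobSq (T - Phat) =
        frobSq (T - Q) - 2 * ∑ i, ∑ j, X i j * (T - Q) i j + frobSq X := by
      simp only [frobSq, Finset.mul_sum, ← Finset.sum_sub_distrib, ← Finset.sum_add_distrib, hX,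
        Matrix.sub_apply]
      refine Finset.sum_congr rfl fun i _ => Finset.sum_congr rfl fun j _ => by ring
    linarith
  have h4 : ∑ i, ∑ j, X i j * (T - Q) i j =
      ∑ i, ∑ j, X i j * W i j + ∑ i, ∑ j, X i j * (T - Q - W) i j := by
    simp only [← Finset.sum_add_distrib, Matrix.sub_apply]
    refine Finset.sum_congr rfl fun i _ => Finset.sum_congr rfl fun j _ => by ring
  have hr : X.rank ≤ 2 * k := by
    have : X.rank ≤ Phat.rank + Q.rank := rank_sub_le Phat Q
    have := h.1
    omega
  have h5 := (abs_le.1 (hW.abs_sum_mul_le hr)).2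
  have h6 := (abs_le.1 (abs_sum_mul_le_sqrt_frobSq X (T - Q - W))).2
  set x := √(frobSq X) with hx
  have hx2 : x ^ 2 = frobSq X := Real.sq_sqrt (frobSq_nonneg X)
  have hx0 : 0 ≤ x := Real.sqrt_nonneg _
  rcases hx0.eq_or_lt with h0 | h0
  · rw [← h0]
    have := hW.nonneg
    positivity
  · refine le_of_mul_le_mul_right ?_ h0
    nlinarith

/-- Trimming fewer than `n / d` vertices, and completing the diagonal, costs `O(√d)` in Frobenius
norm. -/
theorem frobSq_trim_sub_sub_cutMatrix_le {n : ℕ} (hn : 1 ≤ n) {d τ c : ℝ} (hd : 0 < d)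
    (hdn : d ≤ c * n) {A P Q : Matrix (Fin n) (Fin n) ℝ} (hQ : ∀ i j, |Q i j| ≤ d / n)
    (hPQ : ∀ i j, i ≠ j → P i j = Q i j) (hP0 : ∀ i, P i i = 0)
    (hcard : ((Finset.univ.filter fun i => τ < ∑ l, A i l).card : ℝ) * d ≤ n) :
    frobSq (trim τ A - Q - cutMatrix τ A (A - P)) ≤ (2 + c) * d := by
  have hn0 : (0 : ℝ) < n := by exact_mod_cast hn
  set x := (d / n) ^ 2 with hx
  have hQ2 : ∀ i j, Q i j ^ 2 ≤ x := fun i j => by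
    rw [← sq_abs]; exact pow_le_pow_left₀ (abs_nonneg _) (hQ i j) 2
  have hx0 : 0 ≤ x := by positivity
  have hpt : ∀ i j, (trim τ A - Q - cutMatrix τ A (A - P)) i j ^ 2 ≤
      x * ((if τ < ∑ l, A i l then 1 else 0) + (if τ < ∑ l, A j l then 1 else 0) +
        if i = j then 1 else 0) := by
    intro i j
    simp only [trim, cutMatrix, Matrix.sub_apply, Matrix.of_apply]
    have hq := hQ2 i j
    by_cases h1 : τ < ∑ l, A i l
    · simp only [h1, true_or, if_true]
      split_ifs <;> nlinarith
    by_cases h2 : τ < ∑ l, A j l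
    · simp only [h2, or_true, if_true]
      split_ifs <;> nlinarith
    by_cases h3 : i = j
    · subst h3
      simp [h1, hP0]
      exact hq
    · simp [h1, h2, h3, hPQ i j h3]
  have hc : ∀ i : Fin n, ∑ j, (if i = j then (1 : ℝ) else 0) = 1 := fun i => by simp
  set H : ℝ := ((Finset.univ.filter fun i => τ < ∑ l, A i l).card : ℝ) with hH
  have hHs : ∑ i, (if τ < ∑ l, A i l then (1 : ℝ) else 0) = H := by
    rw [Finset.sum_boole]
  calc frobSq (trim τ A - Q - cutMatrix τ A (A - P)) ≤ ∑ i, ∑ j,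
      x * ((if τ < ∑ l, A i l then 1 else 0) + (if τ < ∑ l, A j l then 1 else 0) +
        if i = j then 1 else 0) :=
        Finset.sum_le_sum fun i _ => Finset.sum_le_sum fun j _ => hpt i j
    _ = x * (2 * (H * n) + n) := by
        simp only [← Finset.mul_sum, Finset.sum_add_distrib, hc, hHs, Finset.sum_const,
          Finset.card_univ, Fintype.card_fin, nsmul_eq_mul]
        ring
    _ = d / n * (2 * (H * d)) + d * (d / n) := by rw [hx]; field_simp
    _ ≤ d / n * (2 * n) + d * c := by
        gcongr
        rwa [div_le_iff₀ hn0]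
    _ = _ := by field_simp

end

/-! ### Weighted k-medians -/

section

theorem l1_nonneg {n : ℕ} (x : Fin n → ℝ) : 0 ≤ l1 x := Finset.sum_nonneg fun _ _ => abs_nonneg _

theorem l1_add_le {n : ℕ} (x y : Fin n → ℝ) : l1 (x + y) ≤ l1 x + l1 y := by
  unfold l1
  rw [← Finset.sum_add_distrib]
  exact Finset.sum_le_sum fun j _ => abs_add_le _ _

theorem l1_smul {n : ℕ} (c : ℝ) (x : Fin n → ℝ) : l1 (c • x) = |c| * l1 x := by
  simp [l1, abs_mul, Finset.mul_sum]

theorem l1_sub_comm {n : ℕ} (x y : Fin n → ℝ) : l1 (x - y) = l1 (y - x) := by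
  simp [l1, abs_sub_comm]

theorem l1_sub_le {n : ℕ} (x y w : Fin n → ℝ) : l1 (x - w) ≤ l1 (x - y) + l1 (y - w) := by
  have := l1_add_le (x - y) (y - w)
  rwa [sub_add_sub_cancel] at this

theorem abs_l1_sub_l1_le {n : ℕ} (x y : Fin n → ℝ) : |l1 x - l1 y| ≤ l1 (x - y) := by
  have h1 := l1_add_le (x - y) y
  have h2 := l1_add_le (y - x) x
  rw [sub_add_cancel] at h1 h2
  rw [l1_sub_comm y x] at h2
  rw [abs_le]; constructor <;> linarith

/-- Normalizing two vectors moves them apart by a factor at most `2`, in the weighted distance. -/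
theorem l1_mul_l1_normalize_sub_le {n : ℕ} {x y : Fin n → ℝ} (hx : l1 x ≠ 0) (hy : l1 y ≠ 0) :
    l1 x * l1 ((l1 x)⁻¹ • x - (l1 y)⁻¹ • y) ≤ 2 * l1 (x - y) := by
  have e : l1 x * l1 ((l1 x)⁻¹ • x - (l1 y)⁻¹ • y) =
      l1 ((x - y) + ((l1 y - l1 x) / l1 y) • y) := by
    conv_lhs => rw [← abs_of_nonneg (l1_nonneg x), ← l1_smul]
    congr 1
    rw [abs_of_nonneg (l1_nonneg x), smul_sub, smul_smul, smul_smul, mul_inv_cancel₀ hx, one_smul,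
      sub_div, div_self hy, sub_smul, one_smul, div_eq_mul_inv]
    abel
  rw [e]
  refine (l1_add_le _ _).trans ?_
  rw [l1_smul, abs_div, abs_of_nonneg (l1_nonneg y), div_mul_cancel₀ _ hy, abs_sub_comm]
  linarith [abs_l1_sub_l1_le x y]

theorem loss_le_one {n k : ℕ} (zhat : Fin n → Option (Fin k)) (z : Fin n → Fin k) :
    loss zhat z ≤ 1 := by
  unfold loss
  refine div_le_one_of_le₀ ?_ (Nat.cast_nonneg n)
  have h1 : (⨅ π : Equiv.Perm (Fin k), hammingDist zhat (fun i => some (π (z i)))) ≤ n := by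
    refine (ciInf_le (OrderBot.bddBelow _) (Equiv.refl _)).trans ?_
    simpa using hammingDist_le_card_fintype (x := zhat) (y := fun i => some (z i))
  exact_mod_cast h1

/-- If no estimated label is shared by different communities outside `bad`, and no community is
contained in `bad`, then one permutation of the labels is correct on all vertices outside `bad`:
the `k` communities occupy disjoint nonempty sets of the `k` labels. -/
theorem loss_le_card_div {n k : ℕ} {zhat : Fin n → Option (Fin k)} {z : Fin n → Fin k}
    {bad : Finset (Fin n)} (hlab : ∀ i ∉ bad, zhat i ≠ none)
    (hsep : ∀ i ∉ bad, ∀ j ∉ bad, zhat i = zhat j → z i = z j)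
    (hsize : ∀ u, bad.card < communitySize z u) :
    loss zhat z ≤ bad.card / n := by
  have hex : ∀ u, ∃ i, i ∉ bad ∧ z i = u := by
    intro u
    by_contra h
    push Not at h
    refine (hsize u).not_ge (Finset.card_le_card fun i hi => ?_)
    by_contra h1
    exact h i h1 (Finset.mem_filter.1 hi).2
  choose s hs1 hs2 using hex
  choose lab hlab' using fun u => Option.ne_none_iff_exists'.1 (hlab (s u) (hs1 u))
  have hinj : Function.Injective lab := by
    intro u v huv
    have := hsep (s u) (hs1 u) (s v) (hs1 v) (by rw [hlab', hlab', huv])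
    rwa [hs2, hs2] at this
  set π : Equiv.Perm (Fin k) := Equiv.ofBijective lab (Finite.injective_iff_bijective.1 hinj) with hπ
  have h1 : hammingDist zhat (fun i => some (π (z i))) ≤ bad.card := by
    refine Finset.card_le_card fun i hi => ?_
    by_contra hb
    refine (Finset.mem_filter.1 hi).2 ?_
    obtain ⟨a, ha⟩ := Option.ne_none_iff_exists'.1 (hlab i hb)
    obtain ⟨u, hu⟩ := π.surjective a
    have h2 : zhat (s u) = some (π u) := hlab' u
    have h3 := hsep i hb (s u) (hs1 u) (by rw [ha, h2, hu])
    rw [hs2] at h3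
    show zhat i = some (π (z i))
    rw [ha, h3, hu]
  unfold loss
  gcongr
  exact (ciInf_le (OrderBot.bddBelow _) π).trans h1

theorem sum_nonneg_cost {n k : ℕ} (Phat : Matrix (Fin n) (Fin n) ℝ) (z : Fin n → Option (Fin k))
    (u : Fin k) (v : Fin n → ℝ) :
    0 ≤ ∑ i with l1 (Phat i) ≠ 0 ∧ z i = some u,
      l1 (Phat i) * l1 ((l1 (Phat i))⁻¹ • Phat i - v) :=
  Finset.sum_nonneg fun _ _ => mul_nonneg (l1_nonneg _) (l1_nonneg _)

/-- The sum over the clusters of a labelling is a sum over the vertices with nonzero row. -/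
theorem sum_sum_filter_eq {n k : ℕ} (Phat : Matrix (Fin n) (Fin n) ℝ)
    {z : Fin n → Option (Fin k)} (hz : ∀ i, z i = none ↔ l1 (Phat i) = 0)
    (f : Fin n → Option (Fin k) → ℝ) :
    ∑ u : Fin k, ∑ i with l1 (Phat i) ≠ 0 ∧ z i = some u, f i (some u) =
      ∑ i with l1 (Phat i) ≠ 0, f i (z i) := by
  simp only [Finset.sum_filter]
  rw [Finset.sum_comm]
  refine Finset.sum_congr rfl fun i _ => ?_
  by_cases h : l1 (Phat i) = 0
  · simp [h]
  · obtain ⟨a, ha⟩ := Option.ne_none_iff_exists'.1 (mt (hz i).1 h)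
    simp [h, ha]

theorem kMediansCost_true_le {n k : ℕ} {Phat Q : Matrix (Fin n) (Fin n) ℝ} {z : Fin n → Fin k}
    {V : Fin k → Fin n → ℝ} (hQ : ∀ i, 0 < l1 (Q i)) (hV : ∀ i, (l1 (Q i))⁻¹ • Q i = V (z i)) :
    kMediansCost Phat (fun i => some (z i)) ≤ 2 * ∑ i, l1 (Phat i - Q i) := by
  unfold kMediansCost
  calc _ ≤ ∑ u : Fin k, ∑ i with l1 (Phat i) ≠ 0 ∧ some (z i) = some u,
        l1 (Phat i) * l1 ((l1 (Phat i))⁻¹ • Phat i - V u) := by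
        refine Finset.sum_le_sum fun u _ => ciInf_le ⟨0, ?_⟩ (V u)
        rintro _ ⟨v, rfl⟩
        exact sum_nonneg_cost Phat (fun i => some (z i)) u v
    _ ≤ ∑ u : Fin k, ∑ i with z i = u, 2 * l1 (Phat i - Q i) := by
        refine Finset.sum_le_sum fun u _ => ?_
        refine le_trans (Finset.sum_le_sum fun i hi => ?_)
          (Finset.sum_le_sum_of_subset_of_nonneg (s := Finset.univ.filter fun i =>
            l1 (Phat i) ≠ 0 ∧ some (z i) = some u) (fun i hi => ?_) fun i _ _ => ?_)
        · obtain ⟨h1, h2⟩ := (Finset.mem_filter.1 hi).2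
          rw [← Option.some.inj h2, ← hV i]
          exact l1_mul_l1_normalize_sub_le h1 (hQ i).ne'
        · simp only [Finset.mem_filter, Option.some.injEq] at hi ⊢
          exact ⟨hi.1, hi.2.2⟩
        · exact mul_nonneg zero_le_two (l1_nonneg _)
    _ = 2 * ∑ i, l1 (Phat i - Q i) := by
        rw [Finset.sum_fiberwise (f := fun i => 2 * l1 (Phat i - Q i)), Finset.mul_sum]

/-- Clustering from an approximation `Phat` of `Q` in `ℓ¹`, where the normalized rows of `Q` are
`V u` on community `u`. A misclassified vertex has a poorly approximated row or an estimated
centre at distance at least `Δ / 2` from its own; both are paid for by the total error `E`. -/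
theorem loss_le_of_isClusteringOutput {n k : ℕ} {ε E r Δ : ℝ} (hk : 0 < k) (hε : 0 ≤ ε)
    (hE : 0 < E) (hr : 0 < r) (hΔ : 0 < Δ) (hΔ2 : Δ ≤ 2) {Phat Q : Matrix (Fin n) (Fin n) ℝ}
    {z : Fin n → Fin k} {zhat : Fin n → Option (Fin k)} {V : Fin k → Fin n → ℝ}
    (hnone : ∀ i, zhat i = none ↔ l1 (Phat i) = 0)
    (hopt : kMediansCost Phat zhat ≤ (1 + ε) * kMediansCost Phat fun i => some (z i))
    (hQr : ∀ i, r ≤ l1 (Q i)) (hV : ∀ i, (l1 (Q i))⁻¹ • Q i = V (z i))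
    (hVsep : ∀ u v, u ≠ v → Δ ≤ l1 (V u - V v)) (hPQ : ∑ i, l1 (Phat i - Q i) ≤ E)
    (hsize : ∀ u, 24 * (1 + ε) * E / (r * Δ) < communitySize z u) :
    loss zhat z ≤ 24 * (1 + ε) * E / (r * Δ) / n := by
  have hk0 : (0 : ℝ) < k := by exact_mod_cast hk
  have hcost := (hopt.trans (mul_le_mul_of_nonneg_left
    (kMediansCost_true_le (fun i => hr.trans_le (hQr i)) hV) (by linarith)))
  -- centres that are optimal up to a total of `E`
  have hcen : ∀ u : Fin k, ∃ v : Fin n → ℝ, ∑ i with l1 (Phat i) ≠ 0 ∧ zhat i = some u,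
      l1 (Phat i) * l1 ((l1 (Phat i))⁻¹ • Phat i - v) <
      (⨅ v : Fin n → ℝ, ∑ i with l1 (Phat i) ≠ 0 ∧ zhat i = some u,
        l1 (Phat i) * l1 ((l1 (Phat i))⁻¹ • Phat i - v)) + E / k := fun u =>
    exists_lt_of_ciInf_lt (lt_add_of_pos_right _ (by positivity))
  choose c hc using hcen
  set C : Option (Fin k) → Fin n → ℝ := fun o => o.elim 0 c with hC
  have h1 : ∑ i with l1 (Phat i) ≠ 0,
      l1 (Phat i) * l1 ((l1 (Phat i))⁻¹ • Phat i - C (zhat i)) ≤ kMediansCost Phat zhat + E := by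
    rw [← sum_sum_filter_eq Phat hnone fun i o =>
      l1 (Phat i) * l1 ((l1 (Phat i))⁻¹ • Phat i - C o)]
    refine (Finset.sum_le_sum fun u _ => (hc u).le).trans ?_
    rw [Finset.sum_add_distrib, kMediansCost]
    gcongr
    simp [mul_div_cancel₀ _ hk0.ne']
  have h2 : ∑ i with l1 (Phat i) ≠ 0,
      l1 (Phat i) * l1 ((l1 (Phat i))⁻¹ • Phat i - V (z i)) ≤ 2 * E := by
    calc _ ≤ ∑ i with l1 (Phat i) ≠ 0, 2 * l1 (Phat i - Q i) := by
          refine Finset.sum_le_sum fun i hi => ?_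
          rw [← hV i]
          exact l1_mul_l1_normalize_sub_le (Finset.mem_filter.1 hi).2 (hr.trans_le (hQr i)).ne'
      _ ≤ ∑ i, 2 * l1 (Phat i - Q i) :=
          Finset.sum_le_sum_of_subset_of_nonneg (Finset.filter_subset _ _)
            fun i _ _ => mul_nonneg zero_le_two (l1_nonneg _)
      _ ≤ 2 * E := by rw [← Finset.mul_sum]; gcongr
  have h3 : ∑ i with l1 (Phat i) ≠ 0, l1 (Phat i) * l1 (V (z i) - C (zhat i)) ≤
      5 * (1 + ε) * E := by
    have : ∑ i with l1 (Phat i) ≠ 0, l1 (Phat i) * l1 (V (z i) - C (zhat i)) ≤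
        ∑ i with l1 (Phat i) ≠ 0, l1 (Phat i) * l1 ((l1 (Phat i))⁻¹ • Phat i - V (z i)) +
        ∑ i with l1 (Phat i) ≠ 0, l1 (Phat i) * l1 ((l1 (Phat i))⁻¹ • Phat i - C (zhat i)) := by
      rw [← Finset.sum_add_distrib]
      refine Finset.sum_le_sum fun i _ => ?_
      rw [← mul_add]
      refine mul_le_mul_of_nonneg_left ?_ (l1_nonneg _)
      rw [l1_sub_comm ((l1 (Phat i))⁻¹ • Phat i) (V (z i))]
      exact l1_sub_le _ _ _
    have h4 : (1 + ε) * (2 * ∑ i, l1 (Phat i - Q i)) ≤ (1 + ε) * (2 * E) := by gcongr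
    nlinarith [mul_nonneg hε hE.le]
  set bad1 : Finset (Fin n) := Finset.univ.filter fun i => r / 2 ≤ l1 (Phat i - Q i) with hbad1
  set bad2 : Finset (Fin n) := Finset.univ.filter fun i =>
    l1 (Phat i - Q i) < r / 2 ∧ Δ / 2 ≤ l1 (V (z i) - C (zhat i)) with hbad2
  have hbig : ∀ i, l1 (Phat i - Q i) < r / 2 → r / 2 < l1 (Phat i) := by
    intro i hi
    have := (abs_le.1 (abs_l1_sub_l1_le (Phat i) (Q i))).1
    linarith [hQr i]
  have hc1 : (bad1.card : ℝ) * (r / 2) ≤ E := by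
    rw [← nsmul_eq_mul, ← Finset.sum_const]
    refine le_trans ?_ hPQ
    refine (Finset.sum_le_sum fun i hi => (Finset.mem_filter.1 hi).2).trans ?_
    exact Finset.sum_le_sum_of_subset_of_nonneg (Finset.filter_subset _ _)
      fun i _ _ => l1_nonneg _
  have hc2 : (bad2.card : ℝ) * (r / 2 * (Δ / 2)) ≤ 5 * (1 + ε) * E := by
    rw [← nsmul_eq_mul, ← Finset.sum_const]
    refine le_trans ?_ h3
    refine (Finset.sum_le_sum fun i hi => ?_).trans
      (Finset.sum_le_sum_of_subset_of_nonneg (s := bad2) (fun i hi => ?_)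
        fun i _ _ => mul_nonneg (l1_nonneg _) (l1_nonneg _))
    · obtain ⟨h5, h6⟩ := (Finset.mem_filter.1 hi).2
      have := hbig i h5
      gcongr
      exact l1_nonneg _
    · have := hbig i (Finset.mem_filter.1 hi).2.1
      exact Finset.mem_filter.2 ⟨Finset.mem_univ i, by linarith⟩
  have hcard : ((bad1 ∪ bad2).card : ℝ) ≤ 24 * (1 + ε) * E / (r * Δ) := by
    have h5 : ((bad1 ∪ bad2).card : ℝ) ≤ bad1.card + bad2.card := by
      exact_mod_cast Finset.card_union_le _ _
    refine h5.trans ?_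
    rw [le_div_iff₀ (by positivity)]
    have h6 : (bad1.card : ℝ) * (r / 2) * Δ ≤ E * 2 := by gcongr
    nlinarith [mul_nonneg hε hE.le]
  have hgood : ∀ i ∉ bad1 ∪ bad2, l1 (Phat i - Q i) < r / 2 ∧
      l1 (V (z i) - C (zhat i)) < Δ / 2 := by
    intro i hi
    simp only [Finset.mem_union, hbad1, hbad2, Finset.mem_filter, Finset.mem_univ, true_and,
      not_or, not_le, not_and] at hi
    exact ⟨hi.1, hi.2 hi.1⟩
  refine (loss_le_card_div (bad := bad1 ∪ bad2) (fun i hi h => ?_) (fun i hi j hj hij => ?_)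
    fun u => ?_).trans (by gcongr)
  · have := hbig i (hgood i hi).1
    rw [(hnone i).1 h] at this
    linarith
  · by_contra hne
    have h5 := hVsep _ _ hne
    have h6 := l1_sub_le (V (z i)) (C (zhat i)) (V (z j))
    have h7 := (hgood i hi).2
    have h8 := (hgood j hj).2
    rw [l1_sub_comm, ← hij] at h8
    linarith
  · exact_mod_cast hcard.trans_lt (hsize u)

end

/-! ### Edge probabilities of a model, and the quantity `I` -/

section

/-- The rank-`k` completion of `edgeProb`, without the zero diagonal. -/
def fullProb {n k : ℕ} (θ : Fin n → ℝ) (z : Fin n → Fin k) (B : Matrix (Fin k) (Fin k) ℝ) :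
    Matrix (Fin n) (Fin n) ℝ :=
  Matrix.of fun i j => θ i * θ j * B (z i) (z j)

/-- The row `θ_j B_{u z(j)}` to which the rows of `fullProb` on community `u` are proportional. -/
def communityRow {n k : ℕ} (θ : Fin n → ℝ) (z : Fin n → Fin k) (B : Matrix (Fin k) (Fin k) ℝ)
    (u : Fin k) (j : Fin n) : ℝ := θ j * B u (z j)

theorem rank_fullProb_le {n k : ℕ} (θ : Fin n → ℝ) (z : Fin n → Fin k)
    (B : Matrix (Fin k) (Fin k) ℝ) : (fullProb θ z B).rank ≤ k := by
  have h : fullProb θ z B = (Matrix.of fun i u => if z i = u then θ i else 0 :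
      Matrix (Fin n) (Fin k) ℝ) * (Matrix.of (communityRow θ z B) : Matrix (Fin k) (Fin n) ℝ) := by
    ext i j
    simp [fullProb, communityRow, Matrix.mul_apply, mul_assoc]
  rw [h]
  exact (Matrix.rank_mul_le_left _ _).trans (by simpa using Matrix.rank_le_width _)

theorem fullProb_row {n k : ℕ} (θ : Fin n → ℝ) (z : Fin n → Fin k)
    (B : Matrix (Fin k) (Fin k) ℝ) (i : Fin n) :
    fullProb θ z B i = θ i • communityRow θ z B (z i) := by
  funext j
  simp [fullProb, communityRow, mul_assoc]

section Model

variable {n k : ℕ} {θ : Fin n → ℝ} {p q β δ α : ℝ} {z : Fin n → Fin k}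
  {B : Matrix (Fin k) (Fin k) ℝ}

theorem IsModel.exists_ne_mem (hs : ∀ u, 2 ≤ communitySize z u) (u v : Fin k) :
    ∃ i j, i ≠ j ∧ z i = u ∧ z j = v := by
  obtain ⟨i, hi⟩ := Finset.card_pos.1 (lt_of_lt_of_le two_pos (hs u))
  obtain ⟨j, hj, hne⟩ := Finset.exists_mem_ne (lt_of_lt_of_le one_lt_two (hs v)) i
  exact ⟨i, j, hne.symm, (Finset.mem_filter.1 hi).2, (Finset.mem_filter.1 hj).2⟩

theorem IsModel.B_nonneg (h : IsModel θ p q β δ α z B) (hθ : ∀ i, 0 < θ i)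
    (hs : ∀ u, 2 ≤ communitySize z u) (u v : Fin k) : 0 ≤ B u v := by
  obtain ⟨i, j, hne, hi, hj⟩ := IsModel.exists_ne_mem hs u v
  have h1 := (h.prob_mem i j).1
  simp only [edgeProb, Matrix.of_apply, if_neg hne, hi, hj] at h1
  exact nonneg_of_mul_nonneg_right h1 (mul_pos (hθ i) (hθ j))

theorem IsModel.p_mul_sq_le_one (h : IsModel θ p q β δ α z B) {m : ℝ} (hm : 0 < m) (hp : 0 ≤ p)
    (hθ : ∀ i, m ≤ θ i) (hs : ∀ u, 2 ≤ communitySize z u) (u : Fin k) : p * m ^ 2 ≤ 1 := by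
  obtain ⟨i, j, hne, hi, hj⟩ := IsModel.exists_ne_mem hs u u
  have h1 := (h.prob_mem i j).2
  simp only [edgeProb, Matrix.of_apply, if_neg hne, hi, hj] at h1
  have h2 := hθ i
  have h3 := hθ j
  calc p * m ^ 2 = m * m * p := by ring
    _ ≤ θ i * θ j * B u u := by
        have h4 : 0 ≤ θ i := hm.le.trans h2
        have h5 : 0 ≤ θ j := hm.le.trans h3
        exact mul_le_mul (mul_le_mul h2 h3 hm.le h4) (h.le_within u) hp (mul_nonneg h4 h5)
    _ ≤ 1 := h1

theorem IsModel.B_le (h : IsModel θ p q β δ α z B) (hα : 1 ≤ α) (hp : 0 ≤ p) (u v : Fin k) :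
    B u v ≤ α * p := by
  by_cases huv : u = v
  · subst huv; exact h.within_le u
  · have h1 := h.between_le u v huv
    have h2 := h.gap
    nlinarith

theorem IsModel.abs_fullProb_le (h : IsModel θ p q β δ α z B) (hα : 1 ≤ α) (hp : 0 ≤ p)
    (hθ : ∀ i, 0 < θ i) (hs : ∀ u, 2 ≤ communitySize z u) (i j : Fin n) :
    |fullProb θ z B i j| ≤ α * (p * ‖θ‖ ^ 2) := by
  have h0 := h.B_nonneg hθ hs (z i) (z j)
  have h1 : ∀ i, θ i ≤ ‖θ‖ := fun i => (le_abs_self _).trans (norm_le_pi_norm θ i)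
  have hi := hθ i
  have hj := hθ j
  simp only [fullProb, Matrix.of_apply]
  rw [abs_of_nonneg (by positivity)]
  calc θ i * θ j * B (z i) (z j) ≤ ‖θ‖ * ‖θ‖ * (α * p) := by
        gcongr
        · exact h1 i
        · exact h1 j
        · exact h.B_le hα hp _ _
    _ = _ := by ring

theorem IsModel.le_l1_communityRow (h : IsModel θ p q β δ α z B) {m : ℝ} (hm : 0 < m)
    (hp : 0 ≤ p) (hθ : ∀ i, m ≤ θ i) (u : Fin k) :
    m * p * communitySize z u ≤ l1 (communityRow θ z B u) := by
  unfold l1 communitySize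
  calc m * p * ((Finset.univ.filter fun i => z i = u).card : ℝ) =
      ∑ _j with z _j = u, m * p := by simp [mul_comm]
    _ ≤ ∑ j with z j = u, |communityRow θ z B u j| := by
        refine Finset.sum_le_sum fun j hj => le_trans ?_ (le_abs_self _)
        have := hθ j
        rw [communityRow, (Finset.mem_filter.1 hj).2]
        have h0 : 0 ≤ θ j := hm.le.trans this
        gcongr
        exact h.le_within u
    _ ≤ _ := Finset.sum_le_sum_of_subset_of_nonneg (Finset.filter_subset _ _)
        fun _ _ _ => abs_nonneg _

theorem IsModel.l1_communityRow_le (h : IsModel θ p q β δ α z B) {L : ℝ} (hα : 1 ≤ α)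
    (hp : 0 ≤ p) (hθ : ∀ i, 0 < θ i) (hθL : ∀ i, θ i ≤ L) (hs : ∀ u, 2 ≤ communitySize z u)
    (u : Fin k) : l1 (communityRow θ z B u) ≤ n * (L * (α * p)) := by
  unfold l1
  calc _ ≤ ∑ _j : Fin n, L * (α * p) := by
        refine Finset.sum_le_sum fun j _ => ?_
        have h0 := h.B_nonneg hθ hs u (z j)
        have h1 := hθ j
        have h2 := hθL j
        have h3 := h.B_le hα hp u (z j)
        have h4 : 0 ≤ L := h1.le.trans h2
        rw [communityRow, abs_of_nonneg (by positivity)]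
        gcongr
    _ = _ := by simp

/-- Separation of the normalized rows of two communities, read off on the community whose row has
the smaller norm. -/
theorem IsModel.le_l1_sub_normalized (h : IsModel θ p q β δ α z B) {m L s : ℝ} (hm : 0 < m)
    (hα : 1 ≤ α) (hp : 0 < p) (hθ : ∀ i, m ≤ θ i) (hθL : ∀ i, θ i ≤ L)
    (hs : ∀ u, 2 ≤ communitySize z u) (hs' : ∀ u, s ≤ communitySize z u)
    {u v : Fin k} (huv : u ≠ v) :
    m * s * (p - q) / (n * (L * (α * p))) ≤
      l1 ((l1 (communityRow θ z B u))⁻¹ • communityRow θ z B u -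
        (l1 (communityRow θ z B v))⁻¹ • communityRow θ z B v) := by
  wlog hle : l1 (communityRow θ z B u) ≤ l1 (communityRow θ z B v) generalizing u v
  · rw [l1_sub_comm]
    exact this huv.symm (le_of_not_ge hle)
  have hgap := h.gap
  have hθ0 : ∀ i, 0 < θ i := fun i => hm.trans_le (hθ i)
  have hpos : ∀ u, 0 < l1 (communityRow θ z B u) := by
    intro u
    refine lt_of_lt_of_le ?_ (h.le_l1_communityRow hm hp.le hθ u)
    have : (0 : ℝ) < communitySize z u := by exact_mod_cast lt_of_lt_of_le two_pos (hs u)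
    positivity
  set a := l1 (communityRow θ z B u) with ha
  set b := l1 (communityRow θ z B v) with hb
  have ha0 : 0 < a := hpos u
  have hb0 : 0 < b := hpos v
  have hbL : b ≤ n * (L * (α * p)) := h.l1_communityRow_le hα hp.le hθ0 hθL hs v
  have hsu := hs' u
  calc m * s * (p - q) / (n * (L * (α * p))) ≤
      m * communitySize z u * (p - q) / (n * (L * (α * p))) := by
        have : 0 < p - q := sub_pos.2 hgap
        have : 0 < n * (L * (α * p)) := hb0.trans_le hbL
        gcongr
    _ ≤ m * communitySize z u * (p - q) / b := by
        have : 0 < p - q := sub_pos.2 hgap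
        gcongr
    _ = ∑ _j with z _j = u, m * ((p - q) / b) := by
        rw [Finset.sum_const, nsmul_eq_mul, communitySize]; ring
    _ ≤ ∑ j with z j = u, |(a⁻¹ • communityRow θ z B u - b⁻¹ • communityRow θ z B v) j| := by
        refine Finset.sum_le_sum fun j hj => le_trans ?_ (le_abs_self _)
        have hz := (Finset.mem_filter.1 hj).2
        simp only [Pi.sub_apply, Pi.smul_apply, smul_eq_mul, communityRow, hz]
        have h1 : p / b ≤ B u u * a⁻¹ := by
          rw [← div_eq_mul_inv]
          exact (div_le_div_of_nonneg_left hp.le ha0 hle).trans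
            (by gcongr; exact h.le_within u)
        have h2 : B v u * b⁻¹ ≤ q / b := by
          rw [← div_eq_mul_inv]
          gcongr
          exact h.between_le v u huv.symm
        have h3 : (p - q) / b ≤ B u u * a⁻¹ - B v u * b⁻¹ := by
          rw [sub_div]; linarith
        have h4 : 0 ≤ (p - q) / b := div_nonneg (sub_pos.2 hgap).le hb0.le
        calc m * ((p - q) / b) ≤ θ j * (B u u * a⁻¹ - B v u * b⁻¹) :=
              mul_le_mul (hθ j) h3 h4 (hθ0 j).le
          _ = _ := by ring
    _ ≤ _ := Finset.sum_le_sum_of_subset_of_nonneg (Finset.filter_subset _ _)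
        fun _ _ _ => abs_nonneg _

end Model

section Info

variable {n k : ℕ} {θ : Fin n → ℝ} {p q β : ℝ}

theorem info_rate_pos (hn : 1 ≤ n) (hk : 2 ≤ k) (hβ : 1 ≤ β) :
    0 < if k = 2 then (n : ℝ) / 2 else (n : ℝ) / (β * k) := by
  have hn0 : (0 : ℝ) < n := by exact_mod_cast hn
  have hk0 : (0 : ℝ) < k := by exact_mod_cast lt_of_lt_of_le two_pos hk
  split_ifs <;> positivity

theorem info_pos (hn : 1 ≤ n) (hk : 2 ≤ k) (hβ : 1 ≤ β) (hθ : ∀ i, 0 < θ i) (hq : 0 ≤ q)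
    (hpq : q < p) : 0 < info θ p q k β := by
  have hn0 : (0 : ℝ) < n := by exact_mod_cast hn
  have hc := info_rate_pos hn hk hβ
  set c := if k = 2 then (n : ℝ) / 2 else (n : ℝ) / (β * k) with hcdef
  have hx : 0 < (√p - √q) ^ 2 := by
    have := sub_pos.2 (Real.sqrt_lt_sqrt hq hpq)
    positivity
  have hne : (Finset.univ : Finset (Fin n)).Nonempty := ⟨⟨0, hn⟩, Finset.mem_univ _⟩
  unfold info
  rw [← hcdef]
  refine neg_pos.2 (Real.log_neg ?_ ?_)
  · have := Finset.sum_pos (fun i _ => Real.exp_pos (-(θ i * c * (√p - √q) ^ 2))) hne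
    positivity
  · rw [one_div, inv_mul_lt_iff₀ hn0, mul_one]
    calc ∑ i, Real.exp (-(θ i * c * (√p - √q) ^ 2)) < ∑ _i : Fin n, (1 : ℝ) := by
          refine Finset.sum_lt_sum_of_nonempty hne fun i _ => ?_
          rw [Real.exp_lt_one_iff]
          have := hθ i
          have : 0 < θ i * c * (√p - √q) ^ 2 := by positivity
          linarith
      _ = n := by simp

theorem info_le (hn : 1 ≤ n) (hk : 2 ≤ k) (hβ : 1 ≤ β) {L : ℝ} (hL : 0 ≤ L)
    (hθL : ∀ i, θ i ≤ L) (hq : 0 ≤ q) (hpq : q < p) :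
    info θ p q k β ≤ L * (√n * (p - q) / √p) ^ 2 := by
  have hn0 : (0 : ℝ) < n := by exact_mod_cast hn
  have hp : 0 < p := hq.trans_lt hpq
  have hsp : 0 < √p := Real.sqrt_pos.2 hp
  have hc := info_rate_pos hn hk hβ
  have hcn : (if k = 2 then (n : ℝ) / 2 else (n : ℝ) / (β * k)) ≤ n := by
    have hk1 : (1 : ℝ) ≤ k := by exact_mod_cast (by omega : 1 ≤ k)
    split_ifs
    · linarith
    · exact div_le_self hn0.le (one_le_mul_of_one_le_of_one_le hβ hk1)
  set c := if k = 2 then (n : ℝ) / 2 else (n : ℝ) / (β * k) with hcdef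
  have hsq : 0 ≤ √p - √q := (sub_pos.2 (Real.sqrt_lt_sqrt hq hpq)).le
  have hx : √p - √q ≤ (p - q) / √p := by
    rw [le_div_iff₀ hsp]
    nlinarith [Real.mul_self_sqrt hp.le, Real.mul_self_sqrt hq, Real.sqrt_nonneg q]
  have hy : (√(n : ℝ) * (p - q) / √p) ^ 2 = n * ((p - q) / √p) ^ 2 := by
    rw [mul_div_assoc, mul_pow, Real.sq_sqrt hn0.le]
  rw [hy]
  set G := L * (n * ((p - q) / √p) ^ 2) with hG
  have hg : ∀ i, θ i * c * (√p - √q) ^ 2 ≤ G := by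
    intro i
    have := hθL i
    calc θ i * c * (√p - √q) ^ 2 ≤ L * n * ((p - q) / √p) ^ 2 := by gcongr
      _ = G := by rw [hG]; ring
  unfold info
  rw [← hcdef, neg_le, ← Real.log_exp (-G)]
  refine Real.log_le_log (Real.exp_pos _) ?_
  rw [one_div, le_inv_mul_iff₀ hn0]
  calc (n : ℝ) * Real.exp (-G) = ∑ _i : Fin n, Real.exp (-G) := by simp
    _ ≤ _ := Finset.sum_le_sum fun i _ => Real.exp_le_exp.2 (neg_le_neg (hg i))

theorem inv_le_sqrt_mul_info_rpow (hn : 1 ≤ n) (hk : 2 ≤ k) (hβ : 1 ≤ β) (hθ : ∀ i, 0 < θ i)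
    {L : ℝ} (hL : 0 ≤ L) (hθL : ∀ i, θ i ≤ L) (hq : 0 ≤ q) (hpq : q < p) :
    √p / (√n * (p - q)) ≤ √L * info θ p q k β ^ (-(1 / 2 : ℝ)) := by
  have hI := info_pos hn hk hβ hθ hq hpq
  have hle := info_le hn hk hβ hL hθL hq hpq
  have hp : 0 < p := hq.trans_lt hpq
  have hsp : 0 < √p := Real.sqrt_pos.2 hp
  have hsn : 0 < √(n : ℝ) := Real.sqrt_pos.2 (by exact_mod_cast hn)
  have hd : 0 < p - q := sub_pos.2 hpq
  have h1 : √(info θ p q k β) ≤ √L * (√n * (p - q) / √p) := by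
    rw [← Real.sqrt_sq (show 0 ≤ √(n : ℝ) * (p - q) / √p by positivity), ← Real.sqrt_mul hL]
    exact Real.sqrt_le_sqrt hle
  have h2 : 0 < √(info θ p q k β) := Real.sqrt_pos.2 hI
  rw [Real.rpow_neg hI.le, ← Real.sqrt_eq_rpow, ← div_eq_mul_inv, le_div_iff₀ h2]
  calc √p / (√n * (p - q)) * √(info θ p q k β) ≤
      √p / (√n * (p - q)) * (√L * (√n * (p - q) / √p)) := by gcongr
    _ = √L := by field_simp

end Info

end

/-! ### The concentration event -/

section

theorem failure_prob_le {n : ℕ} (hn : 1 ≤ n) :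
    Real.exp (-(36 * n)) + (n + 1) * (n + 1) * (n ^ 2 + 1) * Real.exp (-(14 * (1 + Real.log n))) +
      Real.exp (-(7 * n)) ≤ (n : ℝ) ^ (-(1 + 1) : ℝ) := by
  have hn1 : (1 : ℝ) ≤ n := by exact_mod_cast hn
  have hn0 : (0 : ℝ) < n := by linarith
  have he : (2 : ℝ) ≤ Real.exp 1 := by
    have := Real.add_one_le_exp (1 : ℝ); linarith
  have hrhs : (n : ℝ) ^ (-(1 + 1) : ℝ) = ((n : ℝ) ^ 2)⁻¹ := by
    rw [Real.rpow_neg hn0.le]; norm_num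
  have h7 : Real.exp (-(7 * n)) ≤ 1 / 4 * ((n : ℝ) ^ 2)⁻¹ := by
    have h1 : (n : ℝ) ≤ Real.exp n := by linarith [Real.add_one_le_exp (n : ℝ)]
    have h2 : (2 : ℝ) ≤ Real.exp n := he.trans (Real.exp_le_exp.2 hn1)
    rw [show (1 / 4 : ℝ) * ((n : ℝ) ^ 2)⁻¹ = (2 * 2 * (n * n) : ℝ)⁻¹ by rw [mul_inv, sq]; norm_num,
      Real.exp_neg]
    gcongr
    calc (2 * 2 * (n * n) : ℝ) ≤ Real.exp n * Real.exp n * (Real.exp n * Real.exp n) := by gcongr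
      _ = Real.exp (4 * n) := by simp only [← Real.exp_add]; congr 1; ring
      _ ≤ Real.exp (7 * n) := Real.exp_le_exp.2 (by linarith)
  have h36 : Real.exp (-(36 * n)) ≤ 1 / 4 * ((n : ℝ) ^ 2)⁻¹ :=
    (Real.exp_le_exp.2 (by linarith)).trans h7
  have h14 : (n + 1) * (n + 1) * (n ^ 2 + 1) * Real.exp (-(14 * (1 + Real.log n))) ≤
      1 / 2 * ((n : ℝ) ^ 2)⁻¹ := by
    have h1 : Real.exp (14 * (1 + Real.log n)) = (Real.exp 1 * n) ^ 14 := by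
      rw [show (14 : ℝ) = (14 : ℕ) by norm_num, Real.exp_nat_mul, Real.exp_add, Real.exp_log hn0]
    have h2 : (2 : ℝ) ^ 14 * n ^ 6 ≤ (Real.exp 1 * n) ^ 14 := by
      rw [mul_pow]
      gcongr
      norm_num
    have h3 : ((n : ℝ) + 1) * (n + 1) * (n ^ 2 + 1) ≤ (2 * n) * (2 * n) * (2 * n ^ 2) := by
      have : (1 : ℝ) ≤ n ^ 2 := one_le_pow₀ hn1
      gcongr <;> linarith
    rw [Real.exp_neg, h1, ← div_eq_mul_inv, div_le_iff₀ (by positivity)]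
    calc ((n : ℝ) + 1) * (n + 1) * (n ^ 2 + 1) ≤ (2 * n) * (2 * n) * (2 * n ^ 2) := h3
      _ ≤ 1 / 2 * ((n : ℝ) ^ 2)⁻¹ * (2 ^ 14 * n ^ 6) := by
          rw [show 1 / 2 * ((n : ℝ) ^ 2)⁻¹ * (2 ^ 14 * n ^ 6) = 8192 * n ^ 4 by field_simp; norm_num]
          nlinarith [pow_pos hn0 4]
      _ ≤ _ := by gcongr
  rw [hrhs]
  linarith

/-- An event that contains all outcomes with the three concentration properties (discrepancy, light
pairs, few vertices of high degree) has probability at least `1 - n⁻²`. -/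
theorem IsRandomAdjacency.le_measure_of_concentration {n : ℕ} {Ω : Type u} [MeasurableSpace Ω]
    {μ : Measure Ω} [IsProbabilityMeasure μ] {A : Ω → Matrix (Fin n) (Fin n) ℝ}
    {P : Matrix (Fin n) (Fin n) ℝ} (hA : IsRandomAdjacency μ A P) (hn : 1 ≤ n) {d τ : ℝ}
    (hd : 0 < d) (hτ : 12 * d ≤ τ) (hP : ∀ i j, 0 ≤ P i j) (hPd : ∀ i j, P i j ≤ d / n)
    (hPs : ∀ i j, P i j = P j i) (hP0 : ∀ i, P i i = 0) {G : Set Ω}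
    (hG : ∀ ω, HasDiscrepancy d (A ω) →
      (∀ v ∈ intNet n, ∀ w ∈ intNet n,
        |∑ i, ∑ j, lightWeight (√d) v w i j * (A ω i j - P i j)| ≤ 400 * n * √d) →
      ((Finset.univ.filter fun i => τ < ∑ l, A ω i l).card : ℝ) * d ≤ n → ω ∈ G) :
    1 - (n : ℝ) ^ (-(1 + 1) : ℝ) ≤ μ.real G := by
  have h1 := hA.measure_exists_light_le hd hP hPd hPs hP0
  have h2 := hA.measure_not_hasDiscrepancy_le hn hd hP hPd hPs hP0
  have h3 := hA.measure_exists_heavy_set_le hd hτ hP hPd hPs hP0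
  set F1 := {ω | ∃ v ∈ intNet n, ∃ w ∈ intNet n,
      400 * n * √d < |∑ i, ∑ j, lightWeight (√d) v w i j * (A ω i j - P i j)|} with hF1
  set F2 := {ω | ¬ HasDiscrepancy d (A ω)} with hF2
  set F3 := {ω | ∃ I : Finset (Fin n), (n : ℝ) ≤ I.card * d ∧
      τ * I.card ≤ edgeSum (A ω) I Finset.univ} with hF3
  have hcover : (Set.univ : Set Ω) ⊆ G ∪ (F1 ∪ F2 ∪ F3) := by
    intro ω _
    by_contra hω
    simp only [Set.mem_union, not_or] at hω
    obtain ⟨hωG, ⟨hω1, hω2⟩, hω3⟩ := hω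
    refine hωG (hG ω (not_not.1 hω2) (fun v hv w hw => ?_) ?_)
    · by_contra h
      exact hω1 ⟨v, hv, w, hw, not_le.1 h⟩
    · by_contra h
      refine hω3 ⟨_, (not_le.1 h).le, ?_⟩
      rw [mul_comm, ← nsmul_eq_mul, ← Finset.sum_const, edgeSum]
      exact Finset.sum_le_sum fun i hi => (Finset.mem_filter.1 hi).2.le
  have h4 := measureReal_mono (μ := μ) hcover
  rw [probReal_univ] at h4
  have h5 := measureReal_union_le (μ := μ) G (F1 ∪ F2 ∪ F3)
  have h6 := measureReal_union_le (μ := μ) (F1 ∪ F2) F3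
  have h7 := measureReal_union_le (μ := μ) F1 F2
  have h8 := failure_prob_le hn
  linarith

/-- The constant in `√(frobSq (Phat - Q)) ≤ frobConst * √d`. -/
def frobConst (K : ℕ) (c c' : ℝ) : ℝ := 2 * (spectralConst c / 8 * √(2 * K : ℕ) + √(2 + c'))

theorem spectralConst_pos {c : ℝ} (hc : 0 ≤ c) : 0 < spectralConst c := by
  unfold spectralConst
  positivity

theorem frobConst_pos {K : ℕ} {c c' : ℝ} (hc : 0 ≤ c) (hc' : 0 ≤ c') : 0 < frobConst K c c' := by
  have := spectralConst_pos hc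
  unfold frobConst
  positivity

theorem sum_l1_sub_le {n : ℕ} (X Y : Matrix (Fin n) (Fin n) ℝ) :
    ∑ i, l1 (X i - Y i) ≤ n * √(frobSq (X - Y)) := by
  have h := abs_sum_mul_le_sqrt_frobSq (Matrix.of fun i j => |(X - Y) i j|)
    (Matrix.of fun _ _ => (1 : ℝ))
  have e1 : frobSq (Matrix.of fun i j => |(X - Y) i j|) = frobSq (X - Y) := by
    simp [frobSq]
  have e2 : √(frobSq (Matrix.of fun _ _ : Fin n => (1 : ℝ))) = n := by
    have : frobSq (Matrix.of fun _ _ : Fin n => (1 : ℝ)) = n * n := by simp [frobSq]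
    rw [this, Real.sqrt_mul_self (Nat.cast_nonneg n)]
  rw [e1, e2, mul_comm] at h
  refine le_trans (le_of_eq ?_) ((le_abs_self _).trans h)
  simp [l1]

/-- On the concentration event, the best low-rank approximation recovers the edge probabilities
up to a Frobenius error `O(√d)`. -/
theorem sqrt_frobSq_sub_fullProb_le {n k K : ℕ} (hn : 1 ≤ n) (hkK : k ≤ K) {d c c' τ : ℝ}
    (hd : 0 < d) (hc : 0 ≤ c) (hτ : τ ≤ c * d) (hdn : d ≤ c' * n)
    {A P Q Phat : Matrix (Fin n) (Fin n) ℝ} (hA : ∀ i j, 0 ≤ A i j)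
    (hsymm : ∀ i j, A i j = A j i) (hP : ∀ i j, 0 ≤ P i j) (hPd : ∀ i j, P i j ≤ d / n)
    (hP0 : ∀ i, P i i = 0) (hQ : ∀ i j, |Q i j| ≤ d / n) (hPQ : ∀ i j, i ≠ j → P i j = Q i j)
    (hrank : Q.rank ≤ k) (hdisc : HasDiscrepancy d A)
    (hlight : ∀ v ∈ intNet n, ∀ w ∈ intNet n,
      |∑ i, ∑ j, lightWeight (√d) v w i j * (A i j - P i j)| ≤ 400 * n * √d)
    (hcard : ((Finset.univ.filter fun i => τ < ∑ l, A i l).card : ℝ) * d ≤ n)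
    (hPhat : IsBestLowRank k (trim τ A) Phat) :
    √(frobSq (Phat - Q)) ≤ frobConst K c c' * √d := by
  have h1 := hPhat.sqrt_frobSq_sub_le hrank
    (bilinBound_cutMatrix hn hd hc hτ hA hsymm hP hPd hdisc hlight)
  have h2 := frobSq_trim_sub_sub_cutMatrix_le hn hd hdn hQ hPQ hP0 hcard
  have hc' : 0 ≤ 2 + c' := by
    have : 0 < c' * n := hd.trans_le hdn
    have := pos_of_mul_pos_left this (Nat.cast_nonneg n)
    linarith
  have h3 : √(frobSq (trim τ A - Q - cutMatrix τ A (A - P))) ≤ √(2 + c') * √d := by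
    rw [← Real.sqrt_mul hc']
    exact Real.sqrt_le_sqrt h2
  have h4 : √((2 * k : ℕ) : ℝ) ≤ √((2 * K : ℕ) : ℝ) := by gcongr
  have h5 := (spectralConst_pos hc).le
  refine h1.trans ?_
  calc _ ≤ 2 * (spectralConst c * √d / 8 * √((2 * K : ℕ) : ℝ) + √(2 + c') * √d) := by gcongr
    _ = _ := by rw [frobConst]; ring

end

/-! ### The loss bound -/

section

theorem LossBound.mono {n k : ℕ} {θ : Fin n → ℝ} {p q β δ α τ ε C D C' : ℝ}
    (h : LossBound.{u} θ p q k β δ α τ ε C C') (hCD : C ≤ D) (hε : 0 ≤ ε)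
    (hI : 0 ≤ info θ p q k β) : LossBound.{u} θ p q k β δ α τ ε D C' := by
  intro z B hM Ω _ μ _ A hA zhat hz
  refine (h z B hM Ω μ A hA zhat hz).trans (measureReal_mono fun ω hω => ?_)
  refine le_trans (show loss (zhat ω) z ≤ _ from hω) ?_
  gcongr

theorem lossBound_of_one_le {n k : ℕ} {θ : Fin n → ℝ} {p q β δ α τ ε C C' : ℝ}
    (h : 1 ≤ C * (1 + ε) * info θ p q k β ^ (-(1 / 2 : ℝ))) :
    LossBound.{u} θ p q k β δ α τ ε C C' := by
  intro z B hM Ω _ μ _ A hA zhat hz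
  have : {ω | loss (zhat ω) z ≤ C * (1 + ε) * info θ p q k β ^ (-(1 / 2 : ℝ))} = Set.univ :=
    Set.eq_univ_of_forall fun ω => (loss_le_one _ _).trans h
  rw [this, probReal_univ]
  linarith [Real.rpow_nonneg (Nat.cast_nonneg n : (0 : ℝ) ≤ n) (-(1 + C'))]

/-- The constant of the loss bound. The summand `1` makes it positive also for `K = 0`. -/
def lossConst (α β : ℝ) (K : ℕ) (m L C₁ : ℝ) : ℝ :=
  2 * β * K * (96 * β ^ 2 * K ^ 2 * L * α / m ^ 3) *
    frobConst K (C₁ / α) (α * (L ^ 2 / m ^ 2 + 1)) * (√(α * (L ^ 2 + 1)) * √L) + 1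

section Large

variable {n k K : ℕ} {θ : Fin n → ℝ} {p q β δ α ε m L C₁ : ℝ}

/-- The loss of the algorithm in terms of the Frobenius error of `Phat`. -/
theorem IsModel.loss_le_of_sqrt_frobSq_le {z : Fin n → Fin k} {B : Matrix (Fin k) (Fin k) ℝ}
    (hM : IsModel θ p q β δ α z B) (hα : 1 ≤ α) (hβ : 1 ≤ β) (hm : 0 < m) (hmL : m ≤ L)
    (hk : 2 ≤ k) (hkK : k ≤ K) (hn : 1 ≤ n) (hp : 0 < p) (hq : 0 ≤ q) (hε : 0 ≤ ε)
    (hθ : ∀ i, m ≤ θ i) (hθL : ∀ i, θ i ≤ L) (hs : ∀ u, 2 ≤ communitySize z u)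
    (hs' : ∀ u, (n : ℝ) / (2 * β * K) ≤ communitySize z u) {F : ℝ} (hF : 0 < F)
    {Phat : Matrix (Fin n) (Fin n) ℝ} {zhat : Fin n → Option (Fin k)}
    (hnone : ∀ i, zhat i = none ↔ l1 (Phat i) = 0)
    (hopt : ∀ z' : Fin n → Fin k,
      kMediansCost Phat zhat ≤ (1 + ε) * kMediansCost Phat fun i => some (z' i))
    (hPhat : √(frobSq (Phat - fullProb θ z B)) ≤ F) :
    loss zhat z ≤ 2 * β * K * ((1 + ε) * (96 * β ^ 2 * K ^ 2 * L * α / m ^ 3) *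
      (F / (n * (p - q)))) := by
  have hn0 : (0 : ℝ) < n := by exact_mod_cast hn
  have hK2 : (2 : ℝ) ≤ K := by exact_mod_cast hk.trans hkK
  have hL : 0 < L := hm.trans_le hmL
  have hpq := hM.gap
  have hd : 0 < p - q := sub_pos.2 hpq
  have hθ0 : ∀ i, 0 < θ i := fun i => hm.trans_le (hθ i)
  have hb1 : 1 ≤ 2 * β * K := by nlinarith
  set s := (n : ℝ) / (2 * β * K) with hsdef
  have hs0 : 0 < s := by positivity
  have hsn : s ≤ n := div_le_self hn0.le hb1
  set r := m * (m * p * s) with hr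
  set Δ := m * s * (p - q) / (n * (L * (α * p))) with hΔ
  set E := n * F with hE
  have hr0 : 0 < r := by positivity
  have hΔ0 : 0 < Δ := by positivity
  have hE0 : 0 < E := by positivity
  have hΔ2 : Δ ≤ 2 := by
    rw [hΔ, div_le_iff₀ (by positivity)]
    have h1 : m * s * (p - q) ≤ L * n * (α * p) := by
      have : p - q ≤ α * p := by nlinarith
      gcongr
    have h2 : 0 < n * (L * (α * p)) := by positivity
    linarith
  -- the bound of `loss_le_of_isClusteringOutput` for these values of `r`, `Δ` and `E`
  have hX : 24 * (1 + ε) * E / (r * Δ) / n =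
      (1 + ε) * (96 * β ^ 2 * K ^ 2 * L * α / m ^ 3) * (F / (n * (p - q))) := by
    rw [hr, hΔ, hE, hsdef]
    field_simp
    ring
  rw [← hX]
  set X := 24 * (1 + ε) * E / (r * Δ) with hXdef
  have hX0 : 0 ≤ X := by positivity
  by_cases hsize : ∀ u, X < communitySize z u
  · have hl1 : ∀ i, l1 (fullProb θ z B i) = θ i * l1 (communityRow θ z B (z i)) := fun i => by
      rw [fullProb_row, l1_smul, abs_of_pos (hθ0 i)]
    have h1 : loss zhat z ≤ X / n := by
      refine loss_le_of_isClusteringOutput (Q := fullProb θ z B)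
        (V := fun u => (l1 (communityRow θ z B u))⁻¹ • communityRow θ z B u) (by omega) hε hE0
        hr0 hΔ0 hΔ2 hnone (hopt z) (fun i => ?_) (fun i => ?_) (fun u v huv => ?_) ?_ hsize
      · rw [hl1]
        have h2 := hM.le_l1_communityRow hm hp.le hθ (z i)
        refine mul_le_mul (hθ i) (le_trans ?_ h2) (by positivity) (hθ0 i).le
        gcongr
        exact hs' _
      · rw [hl1, fullProb_row, smul_smul]
        congr 1
        have := (hθ0 i).ne'
        rw [mul_inv, mul_comm, mul_inv_cancel_left₀ this]
      · exact hM.le_l1_sub_normalized hm hα hp hθ hθL hs hs' huv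
      · exact (sum_l1_sub_le _ _).trans (by rw [hE]; gcongr)
    refine h1.trans (le_mul_of_one_le_left (by positivity) hb1)
  · -- some community is smaller than the number of errors, which is then of order `n`
    push Not at hsize
    obtain ⟨u, hu⟩ := hsize
    refine (loss_le_one _ _).trans ?_
    have h1 : s ≤ X := (hs' u).trans hu
    rw [hsdef, div_le_iff₀ (by positivity)] at h1
    rw [mul_div_assoc', le_div_iff₀ hn0]
    linarith

theorem lossBound_of_large (hα : 1 ≤ α) (hβ : 1 ≤ β) (hm : 0 < m) (hmL : m ≤ L)
    (hC₁ : 12 * α ≤ C₁) (hn : 1 ≤ n) (hnK : 4 * β * K ≤ n) (hk : 2 ≤ k) (hkK : k ≤ K)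
    (hq : 0 < q) (hpq : q < p) (hp : (n : ℝ)⁻¹ ≤ p) (hθ : ∀ i, m ≤ θ i) (hθL : ∀ i, θ i ≤ L)
    (hε : 0 ≤ ε) :
    LossBound.{u} θ p q k β δ α (C₁ * (n * p * ‖θ‖ ^ 2 + 1)) ε (lossConst α β K m L C₁) 1 := by
  intro z B hM Ω _ μ _ A hA zhat hz
  have hn0 : (0 : ℝ) < n := by exact_mod_cast hn
  have hk0 : (0 : ℝ) < k := by exact_mod_cast lt_of_lt_of_le two_pos hk
  have hK0 : (0 : ℝ) < K := by exact_mod_cast lt_of_lt_of_le two_pos (hk.trans hkK)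
  have hkK' : (k : ℝ) ≤ K := by exact_mod_cast hkK
  have hL : 0 < L := hm.trans_le hmL
  have hα0 : 0 < α := by linarith
  have hp0 : 0 < p := hq.trans hpq
  have hθ0 : ∀ i, 0 < θ i := fun i => hm.trans_le (hθ i)
  have hnp : 1 ≤ n * p := by
    rw [inv_le_iff_one_le_mul₀ hn0] at hp; linarith
  -- for these `n` the additive `1` in the size condition costs at most a factor `2`
  have hs2 : 2 ≤ (n : ℝ) / (2 * β * K) := by
    rw [le_div_iff₀ (by positivity)]; linarith
  have hs' : ∀ u, (n : ℝ) / (2 * β * K) ≤ communitySize z u := fun u => by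
    refine le_trans ?_ (hM.size_lower u)
    have h1 : (n : ℝ) / (β * K) ≤ n / (β * k) := by gcongr
    have h2 : (n : ℝ) / (β * K) = 2 * (n / (2 * β * K)) := by field_simp
    linarith
  have hs : ∀ u, 2 ≤ communitySize z u := fun u => by exact_mod_cast hs2.trans (hs' u)
  have hpm : p * m ^ 2 ≤ 1 :=
    hM.p_mul_sq_le_one hm hp0.le hθ hs ⟨0, lt_of_lt_of_le two_pos hk⟩
  have hθn : ‖θ‖ ≤ L := (pi_norm_le_iff_of_nonneg hL.le).2 fun i => by
    rw [Real.norm_eq_abs, abs_of_pos (hθ0 i)]; exact hθL i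
  -- the density scale, for which `P i j ≤ d / n` and the threshold is `(C₁ / α) d`
  set d := α * (n * p * ‖θ‖ ^ 2 + 1) with hd
  have hd0 : 0 < d := by positivity
  have hτ1 : 12 * d ≤ C₁ * (n * p * ‖θ‖ ^ 2 + 1) := by
    calc 12 * d = 12 * α * (n * p * ‖θ‖ ^ 2 + 1) := by rw [hd]; ring
      _ ≤ _ := by gcongr
  have hτ2 : C₁ * (n * p * ‖θ‖ ^ 2 + 1) ≤ C₁ / α * d := by
    apply le_of_eq; rw [hd]; field_simp
  have hC₁0 : 0 < C₁ := by linarith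
  have hdn : d ≤ α * (L ^ 2 / m ^ 2 + 1) * n := by
    -- edge probabilities are at most `1`, which bounds `p`
    have h1 : p ≤ 1 / m ^ 2 := by rwa [le_div_iff₀ (by positivity)]
    have h2 : (1 : ℝ) ≤ n := by exact_mod_cast hn
    have h3 : (n : ℝ) * p * ‖θ‖ ^ 2 ≤ L ^ 2 / m ^ 2 * n := by
      calc (n : ℝ) * p * ‖θ‖ ^ 2 ≤ n * (1 / m ^ 2) * L ^ 2 := by gcongr
        _ = _ := by ring
    rw [hd, mul_assoc α]
    exact mul_le_mul_of_nonneg_left (by linarith) hα0.le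
  have hdp : √d ≤ √(α * (L ^ 2 + 1)) * (√n * √p) := by
    rw [← Real.sqrt_mul hn0.le, ← Real.sqrt_mul (by positivity)]
    refine Real.sqrt_le_sqrt ?_
    have h3 : (n : ℝ) * p * ‖θ‖ ^ 2 ≤ n * p * L ^ 2 := by gcongr
    rw [hd, mul_assoc α]
    exact mul_le_mul_of_nonneg_left (by linarith) hα0.le
  have hQ : ∀ i j, |fullProb θ z B i j| ≤ d / n := fun i j => by
    refine (hM.abs_fullProb_le hα hp0.le hθ0 hs i j).trans ?_
    rw [le_div_iff₀ hn0, hd]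
    nlinarith
  have hPQ : ∀ i j, i ≠ j → edgeProb θ z B i j = fullProb θ z B i j := fun i j h => by
    simp [edgeProb, fullProb, h]
  have hP0 : ∀ i, edgeProb θ z B i i = 0 := fun i => by simp [edgeProb]
  have hPs : ∀ i j, edgeProb θ z B i j = edgeProb θ z B j i := fun i j => by
    simp only [edgeProb, Matrix.of_apply, eq_comm (a := i), hM.symm.apply (z i) (z j),
      mul_comm (θ i)]
  have hPd : ∀ i j, edgeProb θ z B i j ≤ d / n := fun i j => by
    by_cases h : i = j
    · rw [h, hP0]; positivity
    · rw [hPQ i j h]; exact (le_abs_self _).trans (hQ i j)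
  have hP : ∀ i j, 0 ≤ edgeProb θ z B i j := fun i j => (hM.prob_mem i j).1
  refine hA.le_measure_of_concentration hn hd0 hτ1 hP hPd hPs hP0 fun ω hdisc hlight hcard => ?_
  obtain ⟨Phat, hPhat, hnone, hopt⟩ := hz ω
  set Cf := frobConst K (C₁ / α) (α * (L ^ 2 / m ^ 2 + 1)) with hCf
  have hCf0 : 0 < Cf := frobConst_pos (by positivity) (by positivity)
  have h1 := sqrt_frobSq_sub_fullProb_le hn hkK hd0 (by positivity) hτ2 hdn (hA.nonneg ω)
    (hA.symm ω) hP hPd hP0 hQ hPQ (rank_fullProb_le θ z B) hdisc hlight hcard hPhat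
  rw [← hCf] at h1
  have h2 := hM.loss_le_of_sqrt_frobSq_le hα hβ hm hmL hk hkK hn hp0 hq.le hε hθ hθL hs hs'
    (mul_pos hCf0 (Real.sqrt_pos.2 hd0)) hnone hopt h1
  have hI := info_pos hn hk hβ hθ0 hq.le hpq
  have h3 := inv_le_sqrt_mul_info_rpow hn hk hβ hθ0 hL.le hθL hq.le hpq
  set J := info θ p q k β ^ (-(1 / 2 : ℝ)) with hJ
  have hJ0 : 0 < J := Real.rpow_pos_of_pos hI _
  have hpq0 : 0 < p - q := sub_pos.2 hpq
  have hsn : 0 < √(n : ℝ) := Real.sqrt_pos.2 hn0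
  have h4 : Cf * √d / (n * (p - q)) ≤ Cf * (√(α * (L ^ 2 + 1)) * √L) * J := by
    calc Cf * √d / (n * (p - q)) ≤
        Cf * (√(α * (L ^ 2 + 1)) * (√n * √p)) / (√n * √n * (p - q)) := by
          rw [Real.mul_self_sqrt hn0.le]; gcongr
      _ = Cf * √(α * (L ^ 2 + 1)) * (√p / (√n * (p - q))) := by field_simp
      _ ≤ Cf * √(α * (L ^ 2 + 1)) * (√L * J) := by gcongr
      _ = _ := by ring
  show loss (zhat ω) z ≤ _
  calc loss (zhat ω) z ≤ 2 * β * K * ((1 + ε) * (96 * β ^ 2 * K ^ 2 * L * α / m ^ 3) *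
      (Cf * √d / (n * (p - q)))) := h2
    _ ≤ 2 * β * K * ((1 + ε) * (96 * β ^ 2 * K ^ 2 * L * α / m ^ 3) *
      (Cf * (√(α * (L ^ 2 + 1)) * √L) * J)) := by gcongr
    _ = (lossConst α β K m L C₁ - 1) * (1 + ε) * J := by rw [lossConst, ← hCf]; ring
    _ ≤ lossConst α β K m L C₁ * (1 + ε) * J := by
        gcongr
        linarith

end Large

end

end DCBM

end

theorem mainTheorem8
    (α β : ℝ) (hα : 1 ≤ α) (hβ : 1 ≤ β)
    -- the constants in `p / q = O(1)`, `k = O(1)`, `min θ = Ω(1)` and `‖θ‖_∞ = O(1)`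
    (M : ℝ) (K : ℕ) (m L : ℝ) (hm : 0 < m) :
    ∃ C₀ : ℝ, 0 < C₀ ∧ ∀ C₁ : ℝ, C₀ ≤ C₁ →
    ∃ C' : ℝ, 0 < C' ∧ ∃ C : ℝ, 0 < C ∧
    ∀ (θ : ∀ n : ℕ, Fin n → ℝ) (p q δ ε : ℕ → ℝ) (k : ℕ → ℕ),
      Tendsto δ atTop (𝓝 0) →
      (∀ n : ℕ, 1 ≤ n → 0 < q n ∧ 1 < p n / q n ∧ p n / q n ≤ M) →
      (∀ n : ℕ, 1 ≤ n → (n : ℝ)⁻¹ ≤ p n) →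
      (∀ n : ℕ, 1 ≤ n → 2 ≤ k n ∧ k n ≤ K) →
      (∀ n : ℕ, 1 ≤ n → ∀ i, m ≤ θ n i ∧ θ n i ≤ L) →
      (∀ n : ℕ, 1 ≤ n → 0 ≤ ε n) →
      -- the constants `C` and `C'` serve all such sequences, once `n` is large
      (∀ᶠ n : ℕ in atTop,
        DCBM.LossBound.{u} (θ n) (p n) (q n) (k n) β (δ n) α
          (C₁ * ((n : ℝ) * p n * ‖θ n‖ ^ 2 + 1)) (ε n) C C') ∧
      -- with a constant that may depend on the sequence, the bound holds for every `n ≥ 1`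
      (∃ D : ℝ, 0 < D ∧ ∀ n : ℕ, 1 ≤ n →
        DCBM.LossBound.{u} (θ n) (p n) (q n) (k n) β (δ n) α
          (C₁ * ((n : ℝ) * p n * ‖θ n‖ ^ 2 + 1)) (ε n) D C') := by
  refine ⟨12 * α, by linarith, fun C₁ hC₁ => ⟨1, one_pos, ?_⟩⟩
  have hα0 : 0 < α := by linarith
  have hC₁0 : 0 < C₁ := by linarith
  have hmL : m ≤ max m L := le_max_left _ _
  have hL : 0 < max m L := hm.trans_le hmL
  have hC : 0 < DCBM.lossConst α β K m (max m L) C₁ := by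
    have := DCBM.frobConst_pos (K := K) (c := C₁ / α) (c' := α * ((max m L) ^ 2 / m ^ 2 + 1))
      (by positivity) (by positivity)
    unfold DCBM.lossConst
    positivity
  refine ⟨_, hC, fun θ p q δ ε k _ hpq hp hk hθ hε => ?_⟩
  have hθ0 : ∀ n, 1 ≤ n → ∀ i, 0 < θ n i := fun n hn i => hm.trans_le (hθ n hn i).1
  have hqp : ∀ n, 1 ≤ n → q n < p n := fun n hn =>
    (one_lt_div (hpq n hn).1).1 (hpq n hn).2.1
  have hI : ∀ n, 1 ≤ n → 0 < DCBM.info (θ n) (p n) (q n) (k n) β := fun n hn =>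
    DCBM.info_pos hn (hk n hn).1 hβ (hθ0 n hn) (hpq n hn).1.le (hqp n hn)
  have hlarge : ∀ n : ℕ, 1 ≤ n → 4 * β * K ≤ n →
      DCBM.LossBound.{u} (θ n) (p n) (q n) (k n) β (δ n) α
        (C₁ * ((n : ℝ) * p n * ‖θ n‖ ^ 2 + 1)) (ε n)
        (DCBM.lossConst α β K m (max m L) C₁) 1 := fun n hn hnK =>
    DCBM.lossBound_of_large hα hβ hm hmL hC₁ hn hnK (hk n hn).1 (hk n hn).2 (hpq n hn).1
      (hqp n hn) (hp n hn) (fun i => (hθ n hn i).1)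
      (fun i => (hθ n hn i).2.trans (le_max_right _ _)) (hε n hn)
  obtain ⟨N, hN⟩ := exists_nat_ge (4 * β * K)
  have hN' : ∀ n, N ≤ n → 4 * β * K ≤ n := fun n hn => hN.trans (by exact_mod_cast hn)
  refine ⟨?_, ?_⟩
  · filter_upwards [eventually_ge_atTop 1, eventually_ge_atTop N] with n h1 h2
    exact hlarge n h1 (hN' n h2)
  · -- below `N` the trivial bound `loss ≤ 1` suffices, once the constant exceeds `√I`
    set D := ∑ n ∈ Finset.range N, √(DCBM.info (θ n) (p n) (q n) (k n) β) with hD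
    have hD0 : 0 ≤ D := Finset.sum_nonneg fun n _ => Real.sqrt_nonneg _
    refine ⟨DCBM.lossConst α β K m (max m L) C₁ + D, by linarith, fun n hn => ?_⟩
    rcases le_or_gt N n with h | h
    · exact (hlarge n hn (hN' n h)).mono (by linarith) (hε n hn) (hI n hn).le
    · refine DCBM.lossBound_of_one_le ?_
      have hIn := hI n hn
      have h1 : √(DCBM.info (θ n) (p n) (q n) (k n) β) ≤ D :=
        Finset.single_le_sum (f := fun n => √(DCBM.info (θ n) (p n) (q n) (k n) β))
          (fun _ _ => Real.sqrt_nonneg _) (Finset.mem_range.2 h)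
      have h2 : 0 < √(DCBM.info (θ n) (p n) (q n) (k n) β) := Real.sqrt_pos.2 hIn
      rw [Real.rpow_neg hIn.le, ← Real.sqrt_eq_rpow, ← div_eq_mul_inv, le_div_iff₀ h2, one_mul]
      nlinarith [hε n hn, mul_nonneg (hε n hn) (by linarith :
        0 ≤ DCBM.lossConst α β K m (max m L) C₁ + D)]
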